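/- Let $\mathbf{x}=(x_1,x_2,\dots)$, let $h_n(\mathbf{x})$ be the complete homogeneous symmetric function of degree $n$, put $H(z)=\sum_{n\ge 0}h_n(\mathbf{x})z^n$, and define polynomials $Q_n(\mathbf{x},t)$ in $t$, whose coefficients are symmetric functions over $\mathbb{R}$, by $$\sum_{n\ge 0}Q_n(\mathbf{x},t)z^n=\frac{(1-t)H(z)}{H(tz)-tH(z)}.$$ A skew hook is a connected skew diagram with no $2\times 2$ square; skew hooks that differ by a translation are identified, and diagrams are drawn with rows numbered from top to bottom and columns from left to right. For $n\ge 1$ and $k\ge 0$ let $\mathcal{H}_{n,k}$ be the set of skew hooks of size $n$ for which $k$ columns have size $2$ and the remaining $n-2k$ columns, including the last (rightmost) column, have size $1$. Let $$\gamma_{n,k}(\mathbf{x}):=\sum_{D\in\mathcal{H}_{n,k}}s_D(\mathbf{x}),$$ where $s_D(\mathbf{x})$ is the skew Schur function of shape $D$. Then for all $n\ge 1$ $$Q_n(\mathbf{x},t)=\sum_{k=0}^{\lfloor (n-1)/2\rfloor}\gamma_{n,k}(\mathbf{x})\,t^k(1+t)^{n-1-2k}.$$ Consequently $Q_n(\mathbf{x},t)$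 is Schur-$\gamma$-positive with center of symmetry $\frac{n-1}{2}$; that is, there exist symmetric functions $g_0,\dots,g_{\lfloor (n-1)/2\rfloor}$, each a finite linear combination of Schur functions with nonnegative real coefficients, such that $Q_n(\mathbf{x},t)=\sum_{k=0}^{\lfloor (n-1)/2\rfloor}g_k\,t^k(1+t)^{n-1-2k}$. -/

import Mathlib

noncomputable section

namespace SchurGamma

open Polynomial

/-! ### Symmetric functions as formal power series

The variables are `x = (x_0, x_1, x_2, …)`; symmetric functions over `ℝ` are regarded as elements
of the ring of formal power series in these variables. -/

/-- Formal power series over `ℝ` in countably many variables: the ambient ring of the algebra of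
symmetric functions over `ℝ`. -/
abbrev Ser : Type := MvPowerSeries ℕ ℝ

/-- The complete homogeneous symmetric function `h_n`: the sum of all monomials of degree `n`. -/
def hsym (n : ℕ) : Ser := fun m => if m.degree = n then 1 else 0

/-! ### The polynomials `Q_n(x,t)`

`Ser[X]` is the ring of polynomials in `t = X`, and the power series variable over it is `z`. -/

/-- `H(z) = ∑ h_n z^n`. -/
def seriesH : PowerSeries Ser[X] := PowerSeries.mk fun n => C (hsym n)

/-- `H(tz) - t H(z)`. -/
def denom : PowerSeries Ser[X] :=
  PowerSeries.rescale (X : Ser[X]) seriesH - PowerSeries.C (X : Ser[X]) * seriesH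

theorem hsym_zero : hsym 0 = 1 := by
  classical
  ext m
  rw [MvPowerSeries.coeff_one]
  change (if m.degree = 0 then (1 : ℝ) else 0) = _
  simp [Finsupp.degree_eq_zero_iff]

theorem denom_ne_zero : denom ≠ 0 := by
  intro h
  have h0 := congrArg (fun f => (PowerSeries.coeff 0 f).coeff 0) h
  simp only [denom, seriesH, map_sub, PowerSeries.coeff_C_mul, PowerSeries.coeff_rescale,
    PowerSeries.coeff_mk, hsym_zero] at h0
  simp at h0

theorem exists_factor : ∃ G : PowerSeries Ser[X],
    PowerSeries.constantCoeff G = 1 ∧ PowerSeries.C (1 - X : Ser[X]) * G = denom := by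
  refine ⟨PowerSeries.mk fun n =>
    if n = 0 then 1 else -(X * (∑ i ∈ Finset.range (n - 1), X ^ i) * C (hsym n)), ?_, ?_⟩
  · simp
  · ext1 n
    rcases n with _ | n
    · simp only [denom, seriesH, map_sub (PowerSeries.coeff 0), PowerSeries.coeff_C_mul,
        PowerSeries.coeff_rescale, PowerSeries.coeff_mk, hsym_zero]
      simp
    · simp only [denom, seriesH, map_sub (PowerSeries.coeff (n + 1)), PowerSeries.coeff_C_mul, PowerSeries.coeff_rescale,
        PowerSeries.coeff_mk, Nat.add_sub_cancel, Nat.succ_ne_zero,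
        if_false]
      have := mul_neg_geom_sum (X : Ser[X]) n
      linear_combination (-(X : Ser[X]) * C (hsym (n + 1))) * this

/-- The quotient `(1-t) H(z) / (H(tz) - t H(z))` exists and is unique as a power series in `z`
whose coefficients are polynomials in `t`. -/
theorem existsUnique_quotient : ∃! F : PowerSeries Ser[X],
    F * denom = PowerSeries.C (1 - X : Ser[X]) * seriesH := by
  obtain ⟨G, hG, hGd⟩ := exists_factor
  refine ⟨seriesH * PowerSeries.invOfUnit G 1, ?_, ?_⟩
  · have h1 : G * PowerSeries.invOfUnit G 1 = 1 := PowerSeries.mul_invOfUnit G 1 (by simpa using hG)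
    simp only [← hGd]
    linear_combination (PowerSeries.C (1 - X : Ser[X]) * seriesH) * h1
  · intro F hF
    apply mul_right_cancel₀ denom_ne_zero
    rw [hF, ← hGd]
    have h1 : G * PowerSeries.invOfUnit G 1 = 1 := PowerSeries.mul_invOfUnit G 1 (by simpa using hG)
    linear_combination -(PowerSeries.C (1 - X : Ser[X]) * seriesH) * h1

/-- `∑ Q_n(x,t) z^n = (1-t) H(z) / (H(tz) - t H(z))`. -/
def seriesQ : PowerSeries Ser[X] := existsUnique_quotient.choose

theorem seriesQ_mul_denom :
    seriesQ * denom = PowerSeries.C (1 - X : Ser[X]) * seriesH :=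
  existsUnique_quotient.choose_spec.1

/-- The polynomial `Q_n(x,t)` in `t`, the coefficient of `z^n` in the quotient above. -/
def polyQ (n : ℕ) : Ser[X] := PowerSeries.coeff n seriesQ

/-! ### Skew diagrams and skew Schur functions

Cells are pairs `(row, column)`, rows numbered downwards and columns to the right. -/

/-- A skew diagram `λ/μ`, as a set of cells. -/
def IsSkewDiagram (D : Finset (ℕ × ℕ)) : Prop :=
  ∃ lam mu : YoungDiagram, mu ≤ lam ∧ D = lam.cells \ mu.cells

/-- A filling of `D` is semistandard if its rows weakly increase from left to right and its columns
strictly increase from top to bottom. -/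
structure IsSemistandard (D : Finset (ℕ × ℕ)) (T : D → ℕ) : Prop where
  row_weak : ∀ a b : D, a.1.1 = b.1.1 → a.1.2 < b.1.2 → T a ≤ T b
  col_strict : ∀ a b : D, a.1.2 = b.1.2 → a.1.1 < b.1.1 → T a < T b

/-- The exponent vector of the monomial `x^T = ∏ x_{T(c)}`. -/
def content {D : Finset (ℕ × ℕ)} (T : D → ℕ) : ℕ →₀ ℕ := ∑ c, Finsupp.single (T c) 1

/-- Only finitely many fillings have a given content. -/
theorem finite_content (D : Finset (ℕ × ℕ)) (m : ℕ →₀ ℕ) :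
    {T : D → ℕ | IsSemistandard D T ∧ content T = m}.Finite := by
  refine (Set.Finite.pi' (t := fun _ : D => (m.support : Set ℕ))
    fun _ => m.support.finite_toSet).subset ?_
  rintro T ⟨-, rfl⟩ c
  simp only [Finset.mem_coe, Finsupp.mem_support_iff, content, Finsupp.finsetSum_apply]
  intro h
  rw [Finset.sum_eq_zero_iff] at h
  simpa using h c (Finset.mem_univ c)

/-- The skew Schur function `s_D = ∑_T x^T`, over the semistandard fillings `T` of `D`: the
coefficient of a monomial is the number of semistandard fillings with that content. -/
def skewSchur (D : Finset (ℕ × ℕ)) : Ser := fun m =>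
  (Set.ncard {T : D → ℕ | IsSemistandard D T ∧ content T = m} : ℝ)

/-- The Schur function `s_λ`. -/
def schur (lam : YoungDiagram) : Ser := skewSchur lam.cells

/-! ### Skew hooks -/

/-- Connectedness through edges shared by cells. In `ℕ × ℕ`, one cell covers another exactly when
it is its right or lower neighbour. -/
def IsConnectedDiagram (D : Finset (ℕ × ℕ)) : Prop :=
  ((SimpleGraph.hasse (ℕ × ℕ)).induce (D : Set (ℕ × ℕ))).Connected

/-- A skew hook (a connected skew diagram without a `2 × 2` square). Diagrams that differ by a
translation are the same shape; the representative used is the one which meets row `0` and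
column `0`. -/
structure IsSkewHook (D : Finset (ℕ × ℕ)) : Prop where
  skew : IsSkewDiagram D
  connected : IsConnectedDiagram D
  no_square : ¬ ∃ i j, (i, j) ∈ D ∧ (i, j + 1) ∈ D ∧ (i + 1, j) ∈ D ∧ (i + 1, j + 1) ∈ D
  row_zero : ∃ j, (0, j) ∈ D
  col_zero : ∃ i, (i, 0) ∈ D

/-- The indices of the columns of `D`. -/
def columns (D : Finset (ℕ × ℕ)) : Finset ℕ := D.image Prod.snd

/-- The size of column `j` of `D`. -/
def colSize (D : Finset (ℕ × ℕ)) (j : ℕ) : ℕ := (D.filter fun c => c.2 = j).card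

/-- The set `H_{n,k}` of skew hooks of size `n` with `k` columns of size `2` and all the other
columns, the last one included, of size `1`. -/
structure IsHookNK (n k : ℕ) (D : Finset (ℕ × ℕ)) : Prop where
  hook : IsSkewHook D
  size : D.card = n
  size_two : ((columns D).filter fun j => colSize D j = 2).card = k
  other : ∀ j ∈ columns D, colSize D j ≠ 2 → colSize D j = 1
  last : ∀ j ∈ columns D, (∀ i ∈ columns D, i ≤ j) → colSize D j = 1

/-- A coordinate that takes the value `0` on a connected diagram and changes by at most one
between neighbours is smaller than the number of cells. -/
theorem coord_lt_card {D : Finset (ℕ × ℕ)} (hD : IsConnectedDiagram D) (f : ℕ × ℕ → ℕ)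
    (hf : ∀ a b, (SimpleGraph.hasse (ℕ × ℕ)).Adj a b → f b ≤ f a + 1)
    (h0 : ∃ a ∈ D, f a = 0) {b : ℕ × ℕ} (hb : b ∈ D) : f b < D.card := by
  obtain ⟨a, ha, ha0⟩ := h0
  have key : Finset.range (f b + 1) ⊆ D.image f := by
    intro r hr
    rw [Finset.mem_range] at hr
    by_contra hne
    have hne' : ∀ c ∈ D, f c ≠ r := fun c hc h => hne (Finset.mem_image.2 ⟨c, hc, h⟩)
    have hr0 : 0 < r := by have := hne' a ha; omega
    obtain ⟨w⟩ := hD.preconnected ⟨a, ha⟩ ⟨b, hb⟩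
    obtain ⟨d, -, hd1, hd2⟩ := w.exists_boundary_dart {c | f c.1 < r}
      (by change f a < r; omega) (by change ¬ f b < r; omega)
    have h1 := hf _ _ (show (SimpleGraph.hasse (ℕ × ℕ)).Adj d.fst.1 d.snd.1 from d.adj)
    have h2 := hne' _ d.snd.2
    change f d.fst.1 < r at hd1
    change ¬ f d.snd.1 < r at hd2
    omega
  have h1 := Finset.card_le_card key
  have h2 := Finset.card_image_le (s := D) (f := f)
  rw [Finset.card_range] at h1
  omega

theorem hasse_adj_bound (a b : ℕ × ℕ) (h : (SimpleGraph.hasse (ℕ × ℕ)).Adj a b) :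
    b.1 ≤ a.1 + 1 ∧ b.2 ≤ a.2 + 1 := by
  obtain ⟨a1, a2⟩ := a
  obtain ⟨b1, b2⟩ := b
  simp only [SimpleGraph.hasse_adj, Prod.mk_covBy_mk_iff, Nat.covBy_iff_add_one_eq] at h
  simp only
  omega

/-- There are finitely many skew hooks in `H_{n,k}`. -/
theorem finite_hooks (n k : ℕ) : {D | IsHookNK n k D}.Finite := by
  refine ((Finset.range n ×ˢ Finset.range n).powerset.finite_toSet).subset ?_
  intro D hD
  rw [Finset.mem_coe, Finset.mem_powerset]
  intro c hc
  obtain ⟨j, hj⟩ := hD.hook.row_zero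
  obtain ⟨i, hi⟩ := hD.hook.col_zero
  rw [Finset.mem_product, Finset.mem_range, Finset.mem_range, ← hD.size]
  exact ⟨coord_lt_card hD.hook.connected Prod.fst (fun a b h => (hasse_adj_bound a b h).1)
      ⟨_, hj, rfl⟩ hc,
    coord_lt_card hD.hook.connected Prod.snd (fun a b h => (hasse_adj_bound a b h).2)
      ⟨_, hi, rfl⟩ hc⟩

/-- The set `H_{n,k}`, as a finite set. -/
def hooks (n k : ℕ) : Finset (Finset (ℕ × ℕ)) := (finite_hooks n k).toFinset

/-- `γ_{n,k}(x) = ∑_{D ∈ H_{n,k}} s_D(x)`. -/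
def gammaCoeff (n k : ℕ) : Ser := ∑ D ∈ hooks n k, skewSchur D

/-! ### Positivity -/

/-- For a linearly independent family `b`, this says that `s` lies in the span of `b` and its
expansion has nonnegative coefficients. -/
def IsPositive {R ι : Type*} [CommRing R] [Algebra ℝ R] (b : ι → R) (s : R) : Prop :=
  ∃ c : ι →₀ ℝ, (∀ i, 0 ≤ c i) ∧ s = c.sum fun i a => a • b i

/-- `A(t)` is `b`-`γ`-positive, with center of symmetry `d/2`. -/
def IsGammaPositive {R ι : Type*} [CommRing R] [Algebra ℝ R] (b : ι → R) (d : ℕ) (A : R[X]) :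
    Prop :=
  ∃ g : ℕ → R, (∀ k ≤ d / 2, IsPositive b (g k)) ∧
    A = ∑ k ∈ Finset.range (d / 2 + 1), C (g k) * X ^ k * (1 + X) ^ (d - 2 * k)

end SchurGamma

end

noncomputable section

namespace SchurGamma

open Polynomial

/-! Write r_S for the ribbon Schur function `ribbon n S`, the series of words of length n with
descent set S. Concatenating a word with a weakly increasing one leaves only the junction undecided,
so r_S h_r = r_S + r_{S ∪ {n-1}} in length n + r (`ribbon_mul_hsym`).

Call S sparse if it has no two consecutive elements and does not contain the final position n-2.
Comparing coefficients in the definition of Q and cancelling 1-t gives a recursion for Q_n. The sum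
of t^|S| (1+t)^(n-1-2|S|) r_S over sparse S satisfies it: after the product rule, the coefficients
of each r_S agree by an identity for powers of 1+t (`one_add_X_pow_eq`, `sparseWeight_eq`). Hence
`polyQ_eq_sparseSum`.

A skew hook has exactly one cell on each diagonal that it meets, so from its lower left end it is a
path of up and right steps. Semistandard fillings, read along the path, are the words whose descents
are the up steps (`skewSchur_ribbonDiagram`). Columns of size at most 2, with a last column of size
1, mean that the set of up steps is sparse; its size is the number of columns of size 2. This
identifies γ_{n,k} with the sum of r_S over sparse S of size k (`gammaCoeff_eq`).

For positivity, r_S is shown to be a sum of Schur functions over lattice words with ascent set S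
(`ribbon_eq_latticeSum`). By the Pieri rule these sums obey the same product rule as r_S, and that
rule with the case S = ∅ determines everything. The Pieri rule is proved by induction on the number
of variables, from the branching rule `tabSeries_succ` and the bijection `sum_add_remove_strips`. -/

/-! ### Generating series of weighted sets -/

/-- The generating series of a set of objects weighted by exponent vectors. -/
def genSeries {α : Type*} (A : Set α) (wt : α → ℕ →₀ ℕ) : Ser :=
  fun m => (({a ∈ A | wt a = m} : Set α).ncard : ℝ)

/-- Only finitely many members of `A` have a given weight. -/
def FiniteFibers {α : Type*} (A : Set α) (wt : α → ℕ →₀ ℕ) : Prop :=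
  ∀ m, ({a ∈ A | wt a = m} : Set α).Finite

theorem coeff_genSeries {α : Type*} (A : Set α) (wt : α → ℕ →₀ ℕ) (m : ℕ →₀ ℕ) :
    MvPowerSeries.coeff m (genSeries A wt) = (({a ∈ A | wt a = m} : Set α).ncard : ℝ) := rfl

theorem genSeries_congr {α β : Type*} {A : Set α} {B : Set β} {wt : α → ℕ →₀ ℕ}
    {wt' : β → ℕ →₀ ℕ} (f : α → β) (hf : Set.BijOn f A B) (hw : ∀ a ∈ A, wt' (f a) = wt a) :
    genSeries A wt = genSeries B wt' := by
  ext m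
  rw [coeff_genSeries, coeff_genSeries]
  congr 1
  have : ({b ∈ B | wt' b = m} : Set β) = f '' {a ∈ A | wt a = m} := by
    ext b
    constructor
    · rintro ⟨hb, hm⟩
      obtain ⟨a, ha, rfl⟩ := hf.surjOn hb
      exact ⟨a, ⟨ha, by rw [← hw a ha, hm]⟩, rfl⟩
    · rintro ⟨a, ⟨ha, hm⟩, rfl⟩
      exact ⟨hf.mapsTo ha, by rw [hw a ha, hm]⟩
  rw [this, Set.InjOn.ncard_image (hf.injOn.mono fun a ha => ha.1)]

/-- Finiteness of the fibers matters here because `Set.ncard` is 0 on infinite sets, so counts would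
not be additive. -/
theorem genSeries_iUnion {α ι : Type*} {A : Set α} {wt : α → ℕ →₀ ℕ} (hA : FiniteFibers A wt)
    (Q : Finset ι) (B : ι → Set α) (hAB : ∀ a, a ∈ A ↔ ∃ q ∈ Q, a ∈ B q)
    (hdisj : ∀ q ∈ Q, ∀ r ∈ Q, ∀ a, a ∈ B q → a ∈ B r → q = r) :
    genSeries A wt = ∑ q ∈ Q, genSeries (B q) wt := by
  classical
  ext m
  rw [map_sum]
  simp only [coeff_genSeries]
  rw [← Nat.cast_sum]
  congr 1
  have hfin : ∀ q ∈ Q, ({a ∈ B q | wt a = m} : Set α).Finite := fun q hq =>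
    (hA m).subset fun a ha => ⟨(hAB a).2 ⟨q, hq, ha.1⟩, ha.2⟩
  have hu : ({a ∈ A | wt a = m} : Set α) = ⋃ q ∈ Q, {a ∈ B q | wt a = m} := by
    ext a
    simp only [Set.mem_ofPred_eq, Set.mem_iUnion, hAB, exists_prop]
    constructor
    · rintro ⟨⟨q, hq, hb⟩, h⟩; exact ⟨q, hq, hb, h⟩
    · rintro ⟨q, hq, hb, h⟩; exact ⟨⟨q, hq, hb⟩, h⟩
  have hpd : (↑Q : Set ι).PairwiseDisjoint fun q => ({a ∈ B q | wt a = m} : Set α) := by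
    intro q hq r hr hne
    rw [Function.onFun, Set.disjoint_left]
    exact fun a ha hb => hne (hdisj q hq r hr a ha.1 hb.1)
  clear hAB hdisj
  rw [hu]
  clear hu
  induction Q using Finset.induction_on with
  | empty => simp
  | insert q Q hq ih =>
    have hU : (⋃ r ∈ Q, ({a ∈ B r | wt a = m} : Set α)).Finite :=
      Set.Finite.biUnion Q.finite_toSet fun r hr => hfin r (Finset.mem_insert_of_mem hr)
    rw [Finset.set_biUnion_insert, Set.ncard_union_eq ?_ (hfin q (Finset.mem_insert_self q Q)) hU,
      Finset.sum_insert hq, ih]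
    · exact fun r hr => hfin r (Finset.mem_insert_of_mem hr)
    · exact hpd.subset (by simp)
    · rw [Set.disjoint_iUnion₂_right]
      intro r hr
      exact hpd (by simp) (by simp [hr]) (by rintro rfl; exact hq hr)

theorem genSeries_mul {α β : Type*} {A : Set α} {B : Set β} {wt : α → ℕ →₀ ℕ}
    {wt' : β → ℕ →₀ ℕ} (hA : FiniteFibers A wt) (hB : FiniteFibers B wt') :
    genSeries A wt * genSeries B wt' = genSeries (A ×ˢ B) (fun x => wt x.1 + wt' x.2) := by
  classical
  ext m
  rw [MvPowerSeries.coeff_mul]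
  simp only [coeff_genSeries]
  have hfin : ∀ x : (ℕ →₀ ℕ) × (ℕ →₀ ℕ),
      (({a ∈ A | wt a = x.1} : Set α) ×ˢ ({b ∈ B | wt' b = x.2} : Set β)).Finite :=
    fun x => (hA x.1).prod (hB x.2)
  have key : ∀ s : Finset ((ℕ →₀ ℕ) × (ℕ →₀ ℕ)),
      (⋃ x ∈ s, ({a ∈ A | wt a = x.1} : Set α) ×ˢ ({b ∈ B | wt' b = x.2} : Set β)).ncard =
        ∑ x ∈ s, ({a ∈ A | wt a = x.1} : Set α).ncard * ({b ∈ B | wt' b = x.2} : Set β).ncard := by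
    intro s
    induction s using Finset.induction_on with
    | empty => simp
    | insert x s hx ih =>
      have hU : (⋃ y ∈ s, ({a ∈ A | wt a = y.1} : Set α) ×ˢ ({b ∈ B | wt' b = y.2} : Set β)).Finite :=
        Set.Finite.biUnion s.finite_toSet fun y _ => hfin y
      rw [Finset.set_biUnion_insert, Set.ncard_union_eq ?_ (hfin x) hU, Finset.sum_insert hx, ih,
        Set.ncard_prod]
      · rw [Set.disjoint_iUnion₂_right]
        intro y hy
        rw [Set.disjoint_left]
        rintro ⟨a, b⟩ ⟨h1, h2⟩ ⟨h3, h4⟩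
        apply hx
        have : x = y := Prod.ext (h1.2.symm.trans h3.2) (h2.2.symm.trans h4.2)
        rwa [this]
  simp only [← Nat.cast_mul, ← Nat.cast_sum]
  rw [← key]
  congr 2
  ext ⟨a, b⟩
  simp only [Set.mem_iUnion, Set.mem_prod, Set.mem_ofPred_eq, Finset.HasAntidiagonal.mem_antidiagonal, exists_prop,
    Prod.exists]
  constructor
  · rintro ⟨x, y, h, ⟨ha, rfl⟩, hb, rfl⟩; exact ⟨⟨ha, hb⟩, h⟩
  · rintro ⟨⟨ha, hb⟩, h⟩; exact ⟨_, _, h, ⟨ha, rfl⟩, hb, rfl⟩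

/-- The exponent vector of a family of letters. -/
def letterCount {ι : Type*} [Fintype ι] (w : ι → ℕ) : ℕ →₀ ℕ := ∑ c, Finsupp.single (w c) 1

theorem finiteFibers_letterCount {ι : Type*} [Fintype ι] (A : Set (ι → ℕ)) :
    FiniteFibers A letterCount := by
  intro m
  refine (Set.Finite.pi' (t := fun _ : ι => (m.support : Set ℕ))
    fun _ => m.support.finite_toSet).subset ?_
  rintro T ⟨-, rfl⟩ c
  simp only [Finset.mem_coe, Finsupp.mem_support_iff, letterCount, Finsupp.finsetSum_apply]
  intro h
  rw [Finset.sum_eq_zero_iff] at h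
  simpa using h c (Finset.mem_univ c)

theorem skewSchur_eq_genSeries (D : Finset (ℕ × ℕ)) :
    skewSchur D = genSeries {T : D → ℕ | IsSemistandard D T} letterCount := rfl

theorem letterCount_apply {ι : Type*} [Fintype ι] (w : ι → ℕ) (a : ℕ) :
    letterCount w a = (Finset.univ.filter fun i => w i = a).card := by
  classical
  simp [letterCount, Finsupp.finsetSum_apply, Finsupp.single_apply, Finset.sum_boole]

theorem letterCount_comp_equiv {ι κ : Type*} [Fintype ι] [Fintype κ] (e : ι ≃ κ) (w : κ → ℕ) :
    letterCount (w ∘ e) = letterCount w :=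
  e.sum_comp fun c => Finsupp.single (w c) 1

theorem degree_letterCount {ι : Type*} [Fintype ι] (w : ι → ℕ) :
    (letterCount w).degree = Fintype.card ι := by
  simp [letterCount, map_sum]

/-! ### Words with a given descent set -/

/-- The set of descents of the word `w` is `S`. -/
def HasDescents {α : Type*} [LinearOrder α] {n : ℕ} (S : Finset ℕ) (w : Fin n → α) : Prop :=
  ∀ i (h : i + 1 < n), w ⟨i + 1, h⟩ < w ⟨i, by omega⟩ ↔ i ∈ S

theorem hasDescents_empty_iff {α : Type*} [LinearOrder α] {n : ℕ} (w : Fin n → α) :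
    HasDescents ∅ w ↔ Monotone w := by
  constructor
  · intro h
    rcases n with _ | n
    · exact fun i => i.elim0
    · rw [Fin.monotone_iff_le_succ]
      intro i
      have := (h i.1 (by omega)).not.2 (by simp)
      exact not_lt.1 this
  · intro h i hi
    simpa using h (show (⟨i, by omega⟩ : Fin n) ≤ ⟨i + 1, hi⟩ by simp)

theorem HasDescents.congr {α : Type*} [LinearOrder α] {n : ℕ} {S S' : Finset ℕ} {w : Fin n → α}
    (h : HasDescents S w) (hS : ∀ i, i + 1 < n → (i ∈ S ↔ i ∈ S')) : HasDescents S' w :=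
  fun i hi => (h i hi).trans (hS i hi)

theorem HasDescents.mem_iff {α : Type*} [LinearOrder α] {n : ℕ} {S S' : Finset ℕ} {w : Fin n → α}
    (h : HasDescents S w) (h' : HasDescents S' w) {i : ℕ} (hi : i + 1 < n) : i ∈ S ↔ i ∈ S' :=
  (h i hi).symm.trans (h' i hi)

theorem append_mk_lt {α : Type*} {n r i : ℕ} (u : Fin n → α) (v : Fin r → α) (h : i < n + r)
    (hi : i < n) : Fin.append u v ⟨i, h⟩ = u ⟨i, hi⟩ := by
  simp [Fin.append, Fin.addCases, hi]

theorem append_mk_add {α : Type*} {n r i : ℕ} (u : Fin n → α) (v : Fin r → α) (h : n + i < n + r) :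
    Fin.append u v ⟨n + i, h⟩ = v ⟨i, by omega⟩ :=
  Fin.append_right u v ⟨i, by omega⟩

/-- Positions before n-1 compare letters of u and positions from n on compare letters of v. Only the
junction n-1 is unconstrained, and the two alternatives record whether it is a descent. -/
theorem hasDescents_append {α : Type*} [LinearOrder α] {n r : ℕ} (hn : 1 ≤ n) {S : Finset ℕ}
    (hS : S ⊆ Finset.range (n - 1)) (u : Fin n → α) (v : Fin r → α) :
    HasDescents S u ∧ Monotone v ↔
      HasDescents S (Fin.append u v) ∨ HasDescents (insert (n - 1) S) (Fin.append u v) := by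
  rw [← hasDescents_empty_iff]
  have hlt : ∀ i ∈ S, i + 1 < n := fun i hi => by
    have := Finset.mem_range.1 (hS hi); omega
  have left : ∀ S' : Finset ℕ, HasDescents S' (Fin.append u v) → HasDescents S' u := by
    intro S' h i hi
    have := h i (by omega)
    rwa [append_mk_lt u v _ hi, append_mk_lt u v _ (by omega)] at this
  have right : ∀ S' : Finset ℕ, (∀ i ∈ S', i < n) → HasDescents S' (Fin.append u v) →
      HasDescents ∅ v := by
    intro S' hS' h i hi
    have := h (n + i) (by omega)
    simp only [add_assoc n i 1] at this
    rw [append_mk_add, append_mk_add] at this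
    rw [this]
    simp only [Finset.notMem_empty, iff_false]
    intro hc
    have := hS' _ hc
    omega
  constructor
  · rintro ⟨hu, hv⟩
    have aux : ∀ S' : Finset ℕ, (∀ i, i + 1 < n → (i ∈ S ↔ i ∈ S')) → (∀ i ∈ S', i < n) →
        (∀ (h1 : 0 < n) (h2 : 0 < r), v ⟨0, h2⟩ < u ⟨n - 1, by omega⟩ ↔ n - 1 ∈ S') →
        HasDescents S' (Fin.append u v) := by
      intro S' h1 h2 h3 i hi
      rcases lt_trichotomy (i + 1) n with h | h | h
      · rw [append_mk_lt u v _ h, append_mk_lt u v _ (by omega), ← h1 i h]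
        exact hu i h
      · subst h
        have := append_mk_add u v (i := 0) hi
        simp only [add_zero] at this
        rw [this, append_mk_lt u v _ (by omega)]
        exact h3 (by omega) (by omega)
      · obtain ⟨k, rfl⟩ := Nat.exists_eq_add_of_le (show n ≤ i by omega)
        have h4 : n + k ∉ S' := fun hc => by have := h2 _ hc; omega
        simp only [add_assoc n k 1]
        rw [append_mk_add, append_mk_add]
        simpa [h4] using hv k (by omega)
    -- If r = 0 there is no junction, and the first alternative applies.
    by_cases hd : ∀ (h1 : 0 < n) (h2 : 0 < r), ¬ v ⟨0, h2⟩ < u ⟨n - 1, by omega⟩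
    · left
      refine aux S (fun _ _ => Iff.rfl) (fun i hi => by have := hlt i hi; omega) fun h1 h2 => ?_
      simp only [hd h1 h2, false_iff]
      intro hc
      have := hlt _ hc
      omega
    · push Not at hd
      obtain ⟨h1, h2, hd⟩ := hd
      right
      refine aux _ (fun i hi => ?_) (fun i hi => ?_) fun _ _ => ?_
      · rw [Finset.mem_insert]
        have : i ≠ n - 1 := by omega
        simp [this]
      · rw [Finset.mem_insert] at hi
        rcases hi with rfl | hi
        · omega
        · have := hlt i hi; omega
      · simpa using hd
  · rintro (h | h)
    · exact ⟨left _ h, right _ (fun i hi => by have := hlt i hi; omega) h⟩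
    · refine ⟨(left _ h).congr fun i hi => ?_, right _ (fun i hi => ?_) h⟩
      · have : i ≠ n - 1 := by omega
        simp [this]
      · rw [Finset.mem_insert] at hi
        rcases hi with rfl | hi
        · omega
        · have := hlt i hi; omega

/-- Existence comes from sorting; uniqueness because sorted lists that are permutations of each
other coincide. -/
theorem existsUnique_monotone {α : Type*} [LinearOrder α] {r : ℕ} {s : Multiset α}
    (hs : s.card = r) : ∃! w : Fin r → α, Monotone w ∧ Finset.univ.val.map w = s := by
  have hval : ∀ w : Fin r → α, Finset.univ.val.map w = (List.ofFn w : Multiset α) := by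
    intro w
    rw [Fin.univ_def]
    simp [List.ofFn_eq_map]
  subst hs
  have hlen : (s.sort (· ≤ ·)).length = s.card := by simp
  refine ⟨fun i => (s.sort (· ≤ ·)).get (i.cast hlen.symm), ⟨?_, ?_⟩, ?_⟩
  · intro i j hij
    exact (Multiset.pairwise_sort s (· ≤ ·)).sortedLE.monotone_get hij
  · rw [hval]
    conv_rhs => rw [← Multiset.sort_eq s (· ≤ ·)]
    congr 1
    apply List.ext_get
    · simp
    · intro n h1 h2
      simp
  · rintro w ⟨hw, hws⟩
    have h1 : List.ofFn w = s.sort (· ≤ ·) := by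
      apply List.Perm.eq_of_sortedLE (List.sortedLE_ofFn_iff.2 hw)
        (Multiset.pairwise_sort s (· ≤ ·)).sortedLE
      rw [← Multiset.coe_eq_coe, ← hval, hws, Multiset.sort_eq]
    funext i
    have : ∀ l, l = s.sort (· ≤ ·) → ∀ (h : i.1 < l.length), l[i.1] = (s.sort (· ≤ ·))[i.1]'(by
        rw [hlen]; exact i.2) := by
      rintro l rfl h; rfl
    simpa using this _ h1 (by simp)

theorem toFinsupp_map_univ {ι : Type*} [Fintype ι] (w : ι → ℕ) :
    Multiset.toFinsupp (Finset.univ.val.map w) = letterCount w := by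
  classical
  ext a
  rw [letterCount_apply, Multiset.toFinsupp_apply, Multiset.count_map, Finset.card_def,
    Finset.filter_val]
  simp only [eq_comm]

theorem existsUnique_monotone_letterCount {r : ℕ} {m : ℕ →₀ ℕ} (hm : m.degree = r) :
    ∃! w : Fin r → ℕ, Monotone w ∧ letterCount w = m := by
  have := existsUnique_monotone (s := Finsupp.toMultiset m) (r := r) (by
    rw [Finsupp.card_toMultiset, ← hm]; rfl)
  have key : ∀ w : Fin r → ℕ, Finset.univ.val.map w = Finsupp.toMultiset m ↔ letterCount w = m :=
    fun w => by rw [← toFinsupp_map_univ, Multiset.toFinsupp_eq_iff]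
  simpa only [key] using this

theorem existsUnique_antitone_letterCount {r : ℕ} {m : ℕ →₀ ℕ} (hm : m.degree = r) :
    ∃! w : Fin r → ℕ, Antitone w ∧ letterCount w = m := by
  obtain ⟨w, ⟨hw, hc⟩, huniq⟩ := existsUnique_monotone_letterCount hm
  have hrev : ∀ v : Fin r → ℕ, letterCount (v ∘ Fin.rev) = letterCount v :=
    letterCount_comp_equiv Fin.revPerm
  refine ⟨w ∘ Fin.rev, ⟨fun i j h => hw (Fin.rev_le_rev.2 h), by rw [hrev, hc]⟩, ?_⟩
  rintro v ⟨hv, hvc⟩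
  rw [← huniq (v ∘ Fin.rev) ⟨fun i j h => hv (Fin.rev_le_rev.2 h), by rw [hrev, hvc]⟩]
  funext i
  simp

/-- The ribbon Schur function: the sum of the monomials of the words of length `n` with descent
set `S`. -/
def ribbon (n : ℕ) (S : Finset ℕ) : Ser :=
  genSeries {w : Fin n → ℕ | HasDescents S w} letterCount

theorem ribbon_empty (r : ℕ) : ribbon r ∅ = hsym r := by
  ext m
  rw [ribbon, coeff_genSeries]
  change _ = if m.degree = r then (1 : ℝ) else 0
  simp only [hasDescents_empty_iff, Set.mem_ofPred_eq]
  split_ifs with h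
  · obtain ⟨w, hw, huniq⟩ := existsUnique_monotone_letterCount h
    rw [show ({a : Fin r → ℕ | Monotone a ∧ letterCount a = m} : Set _) = {w} from
      Set.ext fun a => ⟨fun ha => huniq a ha, by rintro rfl; exact hw⟩]
    simp
  · rw [show ({a : Fin r → ℕ | Monotone a ∧ letterCount a = m} : Set _) = ∅ from
      Set.eq_empty_of_forall_notMem fun a ha => h (by
        rw [← ha.2, degree_letterCount, Fintype.card_fin])]
    simp

theorem letterCount_append {n r : ℕ} (u : Fin n → ℕ) (v : Fin r → ℕ) :
    letterCount (Fin.append u v) = letterCount u + letterCount v := by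
  simp [letterCount, Fin.sum_univ_add]

/-- `hsym r` is the series of words without descents, so the product counts concatenations as in
`hasDescents_append`. Since r ≥ 1 the junction is an actual position, which makes the two
alternatives exclusive. -/
theorem ribbon_mul_hsym {n r : ℕ} (hn : 1 ≤ n) (hr : 1 ≤ r) {S : Finset ℕ}
    (hS : S ⊆ Finset.range (n - 1)) :
    ribbon n S * hsym r = ribbon (n + r) S + ribbon (n + r) (insert (n - 1) S) := by
  have hnS : n - 1 ∉ S := fun h => by simpa using hS h
  rw [← ribbon_empty, ribbon, ribbon, genSeries_mul (finiteFibers_letterCount _)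
    (finiteFibers_letterCount _)]
  have h1 : genSeries ({w : Fin n → ℕ | HasDescents S w} ×ˢ {w : Fin r → ℕ | HasDescents ∅ w})
      (fun x => letterCount x.1 + letterCount x.2) =
      genSeries {w : Fin (n + r) → ℕ | HasDescents S w ∨ HasDescents (insert (n - 1) S) w}
        letterCount := by
    refine genSeries_congr (fun x => Fin.append x.1 x.2) ⟨?_, ?_, ?_⟩
      fun x _ => letterCount_append _ _
    · rintro ⟨u, v⟩ ⟨hu, hv⟩
      exact (hasDescents_append hn hS u v).1 ⟨hu, (hasDescents_empty_iff v).1 hv⟩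
    · rintro ⟨u, v⟩ - ⟨u', v'⟩ - h
      exact (Fin.appendEquiv n r).injective h
    · intro w hw
      obtain ⟨⟨u, v⟩, rfl⟩ := (Fin.appendEquiv n r).surjective w
      have := (hasDescents_append hn hS u v).2 hw
      exact ⟨(u, v), ⟨this.1, (hasDescents_empty_iff v).2 this.2⟩, rfl⟩
  rw [h1, genSeries_iUnion (finiteFibers_letterCount _) (Finset.univ : Finset Bool)
    (fun b => {w : Fin (n + r) → ℕ | HasDescents (if b then S else insert (n - 1) S) w})]
  · simp [ribbon]
  · intro w; simp [or_comm]
  · have key : ∀ w : Fin (n + r) → ℕ, HasDescents S w → ¬ HasDescents (insert (n - 1) S) w :=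
      fun w hw hw' => hnS ((hw.mem_iff hw' (i := n - 1) (by omega)).2 (by simp))
    rintro (_ | _) - (_ | _) - w h1 h2
    · rfl
    · exact absurd h1 (key w h2)
    · exact absurd h2 (key w h1)
    · rfl

/-! ### The expansion of `Q_n` in ribbon Schur functions -/

/-- Descent sets of words of length `n` without double descents and without a final descent. -/
def IsSparse (n : ℕ) (S : Finset ℕ) : Prop := ∀ i ∈ S, i + 2 < n ∧ i + 1 ∉ S

theorem IsSparse.subset {n : ℕ} {S : Finset ℕ} (h : IsSparse n S) : S ⊆ Finset.range (n - 1) :=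
  fun i hi => Finset.mem_range.2 (by have := (h i hi).1; omega)

/-- S and its shift by one are disjoint subsets of {0, …, n-2}. Thus the exponent n-1-2|S| in
`sparseWeight` is not truncated. -/
theorem IsSparse.two_mul_card_le {n : ℕ} {S : Finset ℕ} (h : IsSparse n S) :
    2 * S.card ≤ n - 1 := by
  have h1 : Disjoint S (S.image Nat.succ) := by
    rw [Finset.disjoint_left]
    intro a ha hb
    obtain ⟨b, hb', rfl⟩ := Finset.mem_image.1 hb
    exact (h b hb').2 ha
  have h2 : S ∪ S.image Nat.succ ⊆ Finset.range (n - 1) := by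
    intro a ha
    rw [Finset.mem_union, Finset.mem_image] at ha
    rw [Finset.mem_range]
    rcases ha with ha | ⟨b, hb, rfl⟩
    · have := (h a ha).1; omega
    · have := (h b hb).1; omega
  have h3 := Finset.card_le_card h2
  rw [Finset.card_union_of_disjoint h1, Finset.card_image_of_injective _ Nat.succ_injective,
    Finset.card_range] at h3
  omega

open Classical in
/-- The coefficient of the ribbon Schur function with descent set `S` in `Q_n`. -/
def sparseWeight (n : ℕ) (S : Finset ℕ) : Ser[X] :=
  if IsSparse n S then X ^ S.card * (1 + X) ^ (n - 1 - 2 * S.card) else 0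

theorem sparseWeight_empty (n : ℕ) : sparseWeight n ∅ = (1 + X) ^ (n - 1) := by
  rw [sparseWeight, if_pos (show IsSparse n ∅ from fun i hi => absurd hi (Finset.notMem_empty i))]
  simp

/-- This is the comparison of coefficients of r_∅ in the recursion for Q. Without the term j = 0,
the second sum for N+1 is 1+x times the one for N; with [m] = 1 + x + … + x^(m-1), the rest is [N+2]
+ x[N] = (1+x)[N+1]. -/
theorem one_add_X_pow_eq {R : Type*} [CommRing R] (x : R) (N : ℕ) :
    (1 + x) ^ N = ∑ i ∈ Finset.range (N + 1), x ^ i +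
      ∑ j ∈ Finset.range N, x * (∑ i ∈ Finset.range (N - 1 - j), x ^ i) * (1 + x) ^ j := by
  induction N with
  | zero => simp
  | succ N ih =>
    rw [Finset.sum_range_succ' _ N]
    have : ∑ j ∈ Finset.range N, x * (∑ i ∈ Finset.range (N + 1 - 1 - (j + 1)), x ^ i) *
        (1 + x) ^ (j + 1) = (1 + x) * ∑ j ∈ Finset.range N,
          x * (∑ i ∈ Finset.range (N - 1 - j), x ^ i) * (1 + x) ^ j := by
      rw [Finset.mul_sum]
      refine Finset.sum_congr rfl fun j _ => ?_
      rw [show N + 1 - 1 - (j + 1) = N - 1 - j by omega]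
      ring
    rw [this]
    simp only [Nat.add_sub_cancel, Nat.sub_zero, pow_zero, mul_one]
    rw [Finset.sum_range_succ _ (N + 1), pow_succ]
    have h1 := Finset.sum_range_succ (fun i => x ^ i) N
    rw [h1] at ih ⊢
    linear_combination (1 + x) * ih

theorem sparseWeight_insert {n s : ℕ} {S : Finset ℕ} (hS : IsSparse (s + 1) S) (hn : s + 2 < n) :
    sparseWeight n (insert s S) = X * sparseWeight (s + 1) S * (1 + X) ^ (n - s - 3) := by
  have hs : s ∉ S := fun h => by have := (hS s h).1; omega
  have hsp : IsSparse n (insert s S) := by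
    intro i hi
    rw [Finset.mem_insert] at hi
    rcases hi with rfl | hi
    · refine ⟨hn, fun h => ?_⟩
      rw [Finset.mem_insert] at h
      rcases h with h | h
      · omega
      · have := (hS _ h).1; omega
    · have := (hS i hi).1
      refine ⟨by omega, fun h => ?_⟩
      rw [Finset.mem_insert] at h
      rcases h with h | h
      · omega
      · exact (hS i hi).2 h
  have hc := hS.two_mul_card_le
  rw [sparseWeight, sparseWeight, if_pos hS, if_pos hsp, Finset.card_insert_of_notMem hs,
    show n - 1 - 2 * (S.card + 1) = (s + 1 - 1 - 2 * S.card) + (n - s - 3) by omega, pow_add,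
    pow_succ]
  ring

theorem isSparse_erase {n s : ℕ} {S : Finset ℕ} (h : IsSparse n S) (hmax : ∀ i ∈ S, i ≤ s)
    (hs : s ∈ S) : IsSparse (s + 1) (S.erase s) := by
  intro i hi
  rw [Finset.mem_erase] at hi
  have h1 := hmax i hi.2
  have h2 := (h i hi.2).2
  refine ⟨?_, fun h3 => h2 (Finset.mem_of_mem_erase h3)⟩
  rcases Nat.lt_or_ge (i + 2) (s + 1) with h4 | h4
  · exact h4
  · exact absurd (show i + 1 ∈ S by rwa [show i + 1 = s by omega]) h2

/-- The comparison of coefficients of r_S in `sparseSum_succ`. In the product of the sum for length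
j+1 with h_{N-j}, r_S arises only from the descent set S without j, and only if S has no element
above j. -/
theorem sparseWeight_eq {N : ℕ} {S : Finset ℕ} (hS : S ⊆ Finset.range N) :
    sparseWeight (N + 1) S =
      (if S = ∅ then ∑ i ∈ Finset.range (N + 1), (X : Ser[X]) ^ i else 0) +
        ∑ j ∈ Finset.range N, X * (∑ i ∈ Finset.range (N - 1 - j), X ^ i) *
          (if S ⊆ Finset.range (j + 1) then sparseWeight (j + 1) (S.erase j) else 0) := by
  rcases S.eq_empty_or_nonempty with rfl | hne
  · simp only [sparseWeight_empty, Finset.empty_subset, if_true, Finset.erase_empty]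
    exact one_add_X_pow_eq X N
  rw [if_neg hne.ne_empty, zero_add]
  obtain ⟨s, hs, hmax⟩ : ∃ s ∈ S, ∀ i ∈ S, i ≤ s :=
    ⟨S.max' hne, S.max'_mem hne, fun i hi => S.le_max' i hi⟩
  obtain ⟨M, rfl⟩ := Nat.exists_eq_add_of_le (show s + 1 ≤ N by
    have := Finset.mem_range.1 (hS hs); omega)
  have hsub : ∀ j, S ⊆ Finset.range (j + 1) ↔ s ≤ j := fun j =>
    ⟨fun h => by have := Finset.mem_range.1 (h hs); omega,
      fun h i hi => Finset.mem_range.2 (by have := hmax i hi; omega)⟩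
  have herase : ∀ j, S.erase (s + 1 + j) = S := fun j =>
    Finset.erase_eq_of_notMem fun h => by have := hmax _ h; omega
  -- With s the maximum of S, indices j < s contribute nothing, j = s contributes the weight of S
  -- without s, and j > s the weight of S itself.
  rw [Finset.sum_range_add, Finset.sum_range_succ, Finset.sum_eq_zero fun j hj => ?_]
  swap
  · rw [if_neg (by rw [hsub]; have := Finset.mem_range.1 hj; omega), mul_zero]
  simp only [hsub, le_refl, if_true, zero_add, herase, show ∀ j, s ≤ s + 1 + j by omega]
  by_cases hsp : IsSparse (s + 1) (S.erase s)
  · have hw : ∀ n, s + 2 < n → sparseWeight n S =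
        X * sparseWeight (s + 1) (S.erase s) * (1 + X) ^ (n - s - 3) := by
      intro n hn
      conv_lhs => rw [← Finset.insert_erase hs]
      exact sparseWeight_insert hsp hn
    -- In length s + 2 the element s is a final descent.
    have hw0 : sparseWeight (s + 2) S = 0 := if_neg fun h => by have := (h s hs).1; omega
    rcases M with _ | M
    · simp [hw0]
    -- What is left is `one_add_X_pow_eq` with exponent M, times the common factor X · `sparseWeight
    -- (s + 1) (S.erase s)`.
    · rw [Finset.sum_range_succ', hw _ (by omega), show s + 1 + 0 + 1 = s + 2 by omega, hw0,
        mul_zero, add_zero, show s + 1 + (M + 1) + 1 - s - 3 = M by omega,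
        one_add_X_pow_eq, mul_add]
      congr 1
      · rw [show s + 1 + (M + 1) - 1 - s = M + 1 by omega]
        generalize ∑ i ∈ Finset.range (M + 1), (X : Ser[X]) ^ i = G
        ring
      · rw [Finset.mul_sum]
        refine Finset.sum_congr rfl fun j _ => ?_
        rw [hw _ (by omega), show s + 1 + (M + 1) - 1 - (s + 1 + (j + 1)) = M - 1 - j by omega,
          show s + 1 + (j + 1) + 1 - s - 3 = j by omega]
        ring
  -- If S without s fails to be sparse in length s + 1, then S is sparse in no length and every term
  -- vanishes.
  · have hz : ∀ n, sparseWeight n S = 0 := fun n => if_neg fun h => hsp (isSparse_erase h hmax hs)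
    rw [hz, sparseWeight, if_neg hsp]; simp [hz]

/-- The combination of ribbon Schur functions that equals `Q_n` for `n ≥ 1`. -/
def sparseSum (n : ℕ) : Ser[X] :=
  ∑ S ∈ (Finset.range (n - 1)).powerset, sparseWeight n S * C (ribbon n S)

/-- The sets S' and S' ∪ {i} produced by `ribbon_mul_hsym` from S' ⊆ {0, …, i-1} run through all
subsets of {0, …, i}, and erasing i recovers S'. -/
theorem sparseSum_mul_hsym {i r : ℕ} (hr : 1 ≤ r) :
    sparseSum (i + 1) * C (hsym r) = ∑ S ∈ (Finset.range (i + r)).powerset,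
      (if S ⊆ Finset.range (i + 1) then sparseWeight (i + 1) (S.erase i) else 0) *
        C (ribbon (i + r + 1) S) := by
  simp only [ite_mul, zero_mul]
  rw [← Finset.sum_filter]
  have h1 : (Finset.range (i + r)).powerset.filter (fun S => S ⊆ Finset.range (i + 1)) =
      (insert i (Finset.range i)).powerset := by
    ext S
    simp only [Finset.mem_filter, Finset.mem_powerset, ← Finset.range_add_one, and_iff_right_iff_imp]
    exact fun h => h.trans (Finset.range_subset_range.2 (by omega))
  rw [h1, Finset.sum_powerset_insert (by simp), ← Finset.sum_add_distrib, sparseSum,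
    Finset.sum_mul, Nat.add_sub_cancel]
  refine Finset.sum_congr rfl fun S hS => ?_
  rw [Finset.mem_powerset] at hS
  have hi : i ∉ S := fun h => by simpa using hS h
  rw [Finset.erase_insert hi, Finset.erase_eq_of_notMem hi, mul_assoc, ← C_mul,
    ribbon_mul_hsym (by omega) hr (by simpa using hS), C_add, mul_add, Nat.add_sub_cancel,
    show i + 1 + r = i + r + 1 by omega]

/-- The recursion that the defining quotient imposes on Q, with the factor 1-t already cancelled. -/
theorem sparseSum_succ (N : ℕ) :
    sparseSum (N + 1) = (∑ i ∈ Finset.range (N + 1), X ^ i) * C (hsym (N + 1)) +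
      ∑ j ∈ Finset.range N, X * (∑ i ∈ Finset.range (N - 1 - j), X ^ i) *
        (sparseSum (j + 1) * C (hsym (N - j))) := by
  have h1 : ∀ j ∈ Finset.range N, X * (∑ i ∈ Finset.range (N - 1 - j), (X : Ser[X]) ^ i) *
        (sparseSum (j + 1) * C (hsym (N - j))) = ∑ S ∈ (Finset.range N).powerset,
        X * (∑ i ∈ Finset.range (N - 1 - j), (X : Ser[X]) ^ i) *
          (if S ⊆ Finset.range (j + 1) then sparseWeight (j + 1) (S.erase j) else 0) *
        C (ribbon (N + 1) S) := by
    intro j hj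
    have := Finset.mem_range.1 hj
    rw [sparseSum_mul_hsym (by omega), Finset.mul_sum, show j + (N - j) = N by omega]
    exact Finset.sum_congr rfl fun S _ => by ring
  rw [Finset.sum_congr rfl h1, Finset.sum_comm, sparseSum, Nat.add_sub_cancel]
  rw [Finset.sum_congr rfl fun S hS => by rw [sparseWeight_eq (Finset.mem_powerset.1 hS)]]
  simp only [add_mul, Finset.sum_add_distrib, Finset.sum_mul (Finset.range N)]
  congr 1
  rw [Finset.sum_eq_single ∅]
  · rw [if_pos rfl, ribbon_empty]
  · intro S _ hS; rw [if_neg hS, zero_mul]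
  · intro h; simp at h

theorem coeff_denom (n : ℕ) : PowerSeries.coeff n denom = (X ^ n - X) * C (hsym n) := by
  simp only [denom, seriesH, map_sub (PowerSeries.coeff n), PowerSeries.coeff_C_mul,
    PowerSeries.coeff_rescale, PowerSeries.coeff_mk]
  ring

theorem polyQ_eq_sparseSum {n : ℕ} (hn : 1 ≤ n) : polyQ n = sparseSum n := by
  have key : (PowerSeries.mk fun n => if n = 0 then 1 else sparseSum n) * denom =
      PowerSeries.C (1 - X : Ser[X]) * seriesH := by
    ext1 n
    rw [PowerSeries.coeff_mul, PowerSeries.coeff_C_mul,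
      Finset.Nat.sum_antidiagonal_eq_sum_range_succ_mk]
    simp only [PowerSeries.coeff_mk, coeff_denom, seriesH]
    rcases n with _ | N
    · simp
    -- The last term carries the constant term 1-t of `denom`, the first one the constant term 1 of
    -- the candidate. In the others, t^(N-j) - t equals (t-1) t (1 + … + t^(N-2-j)).
    · rw [Finset.sum_range_succ, Finset.sum_range_succ']
      simp only [Nat.succ_ne_zero, if_false, if_true, Nat.sub_zero, Nat.sub_self, pow_zero,
        hsym_zero, C_1, mul_one, one_mul, Nat.add_sub_add_right]
      have h1 : ∀ j ∈ Finset.range N, sparseSum (j + 1) * ((X ^ (N - j) - X) * C (hsym (N - j))) =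
          (X - 1) * (X * (∑ i ∈ Finset.range (N - 1 - j), X ^ i) *
            (sparseSum (j + 1) * C (hsym (N - j)))) := by
        intro j hj
        have := Finset.mem_range.1 hj
        have h2 := mul_neg_geom_sum (X : Ser[X]) (N - 1 - j)
        have h3 : (X : Ser[X]) ^ (N - j) = X * X ^ (N - 1 - j) := by
          rw [← pow_succ']; congr 1; omega
        rw [h3]
        linear_combination (X * sparseSum (j + 1) * C (hsym (N - j))) * h2
      rw [Finset.sum_congr rfl h1, ← Finset.mul_sum, sparseSum_succ]
      have h2 := mul_neg_geom_sum (X : Ser[X]) (N + 1)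
      linear_combination C (hsym (N + 1)) * h2
  have h2 : seriesQ = PowerSeries.mk fun n => if n = 0 then 1 else sparseSum n :=
    mul_right_cancel₀ denom_ne_zero (seriesQ_mul_denom.trans key.symm)
  rw [polyQ, h2, PowerSeries.coeff_mk, if_neg (by omega)]

/-! ### The ribbon with a given descent set -/

/-- The number of elements of `S` below `k`. -/
def numBelow (S : Finset ℕ) (k : ℕ) : ℕ := (S.filter (· < k)).card

theorem numBelow_zero (S : Finset ℕ) : numBelow S 0 = 0 := by simp [numBelow]

theorem numBelow_succ_of_mem {S : Finset ℕ} {k : ℕ} (h : k ∈ S) :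
    numBelow S (k + 1) = numBelow S k + 1 := by
  rw [numBelow, numBelow, ← Finset.card_insert_of_notMem (a := k) (by simp)]
  congr 1
  ext i
  simp only [Finset.mem_filter, Finset.mem_insert]
  constructor
  · rintro ⟨h1, h2⟩
    by_cases hi : i = k
    · exact Or.inl hi
    · exact Or.inr ⟨h1, by omega⟩
  · rintro (rfl | ⟨h1, h2⟩)
    · exact ⟨h, by omega⟩
    · exact ⟨h1, by omega⟩

theorem numBelow_succ_of_notMem {S : Finset ℕ} {k : ℕ} (h : k ∉ S) :
    numBelow S (k + 1) = numBelow S k := by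
  rw [numBelow, numBelow]
  congr 1
  refine Finset.filter_congr fun i hi => ?_
  have : i ≠ k := fun hc => h (hc ▸ hi)
  omega

theorem numBelow_le_card (S : Finset ℕ) (k : ℕ) : numBelow S k ≤ S.card :=
  Finset.card_filter_le _ _

theorem numBelow_le (S : Finset ℕ) (k : ℕ) : numBelow S k ≤ k := by
  refine (Finset.card_le_card fun i hi => ?_).trans (Finset.card_range k).le
  exact Finset.mem_range.2 (Finset.mem_filter.1 hi).2

theorem numBelow_of_subset {S : Finset ℕ} {k : ℕ} (h : S ⊆ Finset.range k) :
    numBelow S k = S.card := by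
  rw [numBelow, Finset.filter_true_of_mem fun i hi => Finset.mem_range.1 (h hi)]

/-- The `k`-th cell, counted from the lower left end, of the ribbon that goes up after the
cells with index in `S` and to the right after the others. -/
def ribbonCell (S : Finset ℕ) (k : ℕ) : ℕ × ℕ := (S.card - numBelow S k, k - numBelow S k)

theorem ribbonCell_succ_of_mem {S : Finset ℕ} {k : ℕ} (h : k ∈ S) :
    (ribbonCell S (k + 1)).1 + 1 = (ribbonCell S k).1 ∧
      (ribbonCell S (k + 1)).2 = (ribbonCell S k).2 := by
  have h1 := numBelow_succ_of_mem h
  have h2 := numBelow_le_card S (k + 1)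
  simp only [ribbonCell]
  omega

theorem ribbonCell_succ_of_notMem {S : Finset ℕ} {k : ℕ} (h : k ∉ S) :
    (ribbonCell S (k + 1)).1 = (ribbonCell S k).1 ∧
      (ribbonCell S (k + 1)).2 = (ribbonCell S k).2 + 1 := by
  have h1 := numBelow_succ_of_notMem h
  have h2 := numBelow_le S k
  simp only [ribbonCell]
  omega

/-- Each step, up or right, raises column minus row by one, so the diagonal of a cell determines its
index. -/
theorem ribbonCell_diagonal (S : Finset ℕ) (k : ℕ) :
    (ribbonCell S k).2 + S.card = (ribbonCell S k).1 + k := by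
  have h1 := numBelow_le S k
  have h2 := numBelow_le_card S k
  simp only [ribbonCell]
  omega

theorem ribbonCell_injective (S : Finset ℕ) : Function.Injective (ribbonCell S) := by
  intro k l h
  have h1 := ribbonCell_diagonal S k
  have h2 := ribbonCell_diagonal S l
  rw [h] at h1
  omega

theorem ribbonCell_row_antitone (S : Finset ℕ) : Antitone fun k => (ribbonCell S k).1 := by
  refine antitone_nat_of_succ_le fun k => ?_
  by_cases h : k ∈ S
  · have := (ribbonCell_succ_of_mem h).1; omega
  · exact (ribbonCell_succ_of_notMem h).1.le

theorem ribbonCell_col_monotone (S : Finset ℕ) : Monotone fun k => (ribbonCell S k).2 := by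
  refine monotone_nat_of_le_succ fun k => ?_
  by_cases h : k ∈ S
  · exact (ribbonCell_succ_of_mem h).2.ge
  · have := (ribbonCell_succ_of_notMem h).2; omega

theorem notMem_of_row_eq {S : Finset ℕ} {k l i : ℕ} (h : (ribbonCell S k).1 = (ribbonCell S l).1)
    (hk : k ≤ i) (hl : i < l) : i ∉ S := by
  intro hi
  have h1 := (ribbonCell_succ_of_mem hi).1
  have h2 : (ribbonCell S i).1 ≤ (ribbonCell S k).1 := ribbonCell_row_antitone S hk
  have h3 : (ribbonCell S l).1 ≤ (ribbonCell S (i + 1)).1 := ribbonCell_row_antitone S hl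
  omega

theorem mem_of_col_eq {S : Finset ℕ} {k l i : ℕ} (h : (ribbonCell S k).2 = (ribbonCell S l).2)
    (hk : k ≤ i) (hl : i < l) : i ∈ S := by
  by_contra hi
  have h1 := (ribbonCell_succ_of_notMem hi).2
  have h2 : (ribbonCell S k).2 ≤ (ribbonCell S i).2 := ribbonCell_col_monotone S hk
  have h3 : (ribbonCell S (i + 1)).2 ≤ (ribbonCell S l).2 := ribbonCell_col_monotone S hl
  omega

/-- The ribbon with `n` cells that goes up after the cells with index in `S`. -/
def ribbonDiagram (n : ℕ) (S : Finset ℕ) : Finset (ℕ × ℕ) := (Finset.range n).image (ribbonCell S)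

theorem mem_ribbonDiagram {n : ℕ} {S : Finset ℕ} {c : ℕ × ℕ} :
    c ∈ ribbonDiagram n S ↔ ∃ k < n, ribbonCell S k = c := by
  simp [ribbonDiagram]

theorem card_ribbonDiagram (n : ℕ) (S : Finset ℕ) : (ribbonDiagram n S).card = n := by
  rw [ribbonDiagram, Finset.card_image_of_injective _ (ribbonCell_injective S), Finset.card_range]

/-- The cells of a ribbon, numbered from the lower left end. -/
def ribbonEquiv (n : ℕ) (S : Finset ℕ) : Fin n ≃ ribbonDiagram n S :=
  Equiv.ofBijective (fun k => ⟨ribbonCell S k, mem_ribbonDiagram.2 ⟨k, k.2, rfl⟩⟩) <| by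
    constructor
    · intro k l h
      exact Fin.ext (ribbonCell_injective S (congrArg Subtype.val h))
    · rintro ⟨c, hc⟩
      obtain ⟨k, hk, rfl⟩ := mem_ribbonDiagram.1 hc
      exact ⟨⟨k, hk⟩, rfl⟩

/-- An up step forces a strict decrease and a right step a weak increase. Cells in the same row or
column are joined by steps of one kind only, so the conditions on neighbours chain together. -/
theorem isSemistandard_ribbon_iff {n : ℕ} {S : Finset ℕ} (T : ribbonDiagram n S → ℕ) :
    IsSemistandard (ribbonDiagram n S) T ↔ HasDescents S (T ∘ ribbonEquiv n S) := by
  have hval : ∀ k, (ribbonEquiv n S k).1 = ribbonCell S k := fun k => rfl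
  constructor
  · intro hT i hi
    constructor
    · intro h
      by_contra hc
      have h1 := ribbonCell_succ_of_notMem hc
      refine absurd h (not_lt.2 (hT.row_weak _ _ ?_ ?_)) <;> simp only [hval] <;> omega
    · intro h
      have h1 := ribbonCell_succ_of_mem h
      refine hT.col_strict _ _ ?_ ?_ <;> simp only [hval] <;> omega
  · intro h
    have weak : ∀ k l, (hkl : k ≤ l) → ∀ hl : l < n, (∀ i, k ≤ i → i < l → i ∉ S) →
        T (ribbonEquiv n S ⟨k, by omega⟩) ≤ T (ribbonEquiv n S ⟨l, hl⟩) := by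
      intro k l hkl
      induction l, hkl using Nat.le_induction with
      | base => intro _ _; exact le_rfl
      | succ l hkl ih =>
        intro hl hS
        refine (ih (by omega) fun i h1 h2 => hS i h1 (by omega)).trans ?_
        exact not_lt.1 fun hc => hS l hkl (by omega) ((h l hl).1 hc)
    have strict : ∀ k l, (hkl : k ≤ l) → ∀ hl : l < n, k < l → (∀ i, k ≤ i → i < l → i ∈ S) →
        T (ribbonEquiv n S ⟨l, hl⟩) < T (ribbonEquiv n S ⟨k, by omega⟩) := by
      intro k l hkl
      induction l, hkl using Nat.le_induction with
      | base => intro _ h; exact absurd h (lt_irrefl _)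
      | succ l hkl ih =>
        intro hl _ hS
        have h1 := (h l hl).2 (hS l hkl (by omega))
        rcases hkl.eq_or_lt with rfl | hlt
        · exact h1
        · exact lt_trans h1 (ih (by omega) hlt fun i h1 h2 => hS i h1 (by omega))
    constructor
    · intro a b h1 h2
      obtain ⟨k, rfl⟩ := (ribbonEquiv n S).surjective a
      obtain ⟨l, rfl⟩ := (ribbonEquiv n S).surjective b
      simp only [hval] at h1 h2
      have hkl : k.1 ≤ l.1 := by
        by_contra hc
        have := ribbonCell_col_monotone S (show l.1 ≤ k.1 by omega)
        simp only at this
        omega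
      exact weak k.1 l.1 hkl l.2 fun i => notMem_of_row_eq h1
    · intro a b h1 h2
      obtain ⟨k, rfl⟩ := (ribbonEquiv n S).surjective a
      obtain ⟨l, rfl⟩ := (ribbonEquiv n S).surjective b
      simp only [hval] at h1 h2
      have hkl : l.1 < k.1 := by
        by_contra hc
        have := ribbonCell_row_antitone S (show k.1 ≤ l.1 by omega)
        simp only at this
        omega
      exact strict l.1 k.1 hkl.le k.2 hkl fun i => mem_of_col_eq h1.symm

theorem skewSchur_ribbonDiagram (n : ℕ) (S : Finset ℕ) :
    skewSchur (ribbonDiagram n S) = ribbon n S := by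
  rw [skewSchur_eq_genSeries, ribbon]
  refine genSeries_congr (fun T => T ∘ ribbonEquiv n S) ⟨?_, ?_, ?_⟩
    fun T _ => letterCount_comp_equiv _ T
  · exact fun T hT => (isSemistandard_ribbon_iff T).1 hT
  · exact ((ribbonEquiv n S).surjective.injective_comp_right).injOn
  · intro w hw
    have hw' : (w ∘ (ribbonEquiv n S).symm) ∘ ribbonEquiv n S = w := by
      funext i; simp
    refine ⟨w ∘ (ribbonEquiv n S).symm, (isSemistandard_ribbon_iff _).2 ?_, hw'⟩
    rw [hw']
    exact hw

/-! ### Ribbons are skew hooks -/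

/-- Take for λ the lower closure of D and for μ the cells of λ that lie above no cell of D in the
product order; convexity gives λ/μ = D. -/
theorem isSkewDiagram_of_ordConnected {D : Finset (ℕ × ℕ)}
    (h : ∀ a ∈ D, ∀ b ∈ D, ∀ c, a ≤ c → c ≤ b → c ∈ D) : IsSkewDiagram D := by
  classical
  let L : Finset (ℕ × ℕ) := D.biUnion Finset.Iic
  have hL : ∀ c, c ∈ L ↔ ∃ b ∈ D, c ≤ b := by simp [L]
  let lam : YoungDiagram := ⟨L, by
    intro a b hab ha
    obtain ⟨d, hd, had⟩ := (hL a).1 ha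
    exact (hL b).2 ⟨d, hd, hab.trans had⟩⟩
  let mu : YoungDiagram := ⟨L.filter fun c => ∀ a ∈ D, ¬ a ≤ c, by
    intro a b hab ha
    simp only [Finset.coe_filter, Set.mem_ofPred_eq] at ha ⊢
    obtain ⟨d, hd, had⟩ := (hL a).1 ha.1
    exact ⟨(hL b).2 ⟨d, hd, hab.trans had⟩, fun e he hc => ha.2 e he (hc.trans hab)⟩⟩
  refine ⟨lam, mu, ?_, ?_⟩
  · intro c hc
    exact (Finset.mem_filter.1 hc).1
  · ext c
    change c ∈ D ↔ c ∈ L \ L.filter fun c => ∀ a ∈ D, ¬ a ≤ c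
    rw [Finset.mem_sdiff, Finset.mem_filter, hL]
    constructor
    · exact fun hc => ⟨⟨c, hc, le_rfl⟩, fun h1 => h1.2 c hc le_rfl⟩
    · rintro ⟨⟨b, hb, hcb⟩, h1⟩
      have : ∃ a ∈ D, a ≤ c := by
        by_contra hc
        push Not at hc
        exact h1 ⟨⟨b, hb, hcb⟩, hc⟩
      obtain ⟨a, ha, hac⟩ := this
      exact h a ha b hb c hac hcb

theorem IsSkewDiagram.ordConnected {D : Finset (ℕ × ℕ)} (h : IsSkewDiagram D) {a b c : ℕ × ℕ}
    (ha : a ∈ D) (hb : b ∈ D) (hac : a ≤ c) (hcb : c ≤ b) : c ∈ D := by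
  obtain ⟨lam, mu, -, rfl⟩ := h
  rw [Finset.mem_sdiff] at ha hb ⊢
  exact ⟨lam.isLowerSet hcb hb.1, fun hc => ha.2 (mu.isLowerSet hac hc)⟩

theorem ribbonCell_add_of_row_eq {S : Finset ℕ} {k l : ℕ}
    (h : (ribbonCell S k).1 = (ribbonCell S l).1) {d : ℕ} (hd : k + d ≤ l) :
    ribbonCell S (k + d) = ((ribbonCell S k).1, (ribbonCell S k).2 + d) := by
  induction d with
  | zero => rfl
  | succ d ih =>
    have h1 := ribbonCell_succ_of_notMem (notMem_of_row_eq h (i := k + d) (by omega) (by omega))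
    rw [ih (by omega)] at h1
    exact Prod.ext h1.1 (h1.2.trans (by simp only; omega))

theorem ribbonCell_add_of_col_eq {S : Finset ℕ} {k l : ℕ}
    (h : (ribbonCell S k).2 = (ribbonCell S l).2) {d : ℕ} (hd : k + d ≤ l) :
    (ribbonCell S (k + d)).1 + d = (ribbonCell S k).1 ∧
      (ribbonCell S (k + d)).2 = (ribbonCell S k).2 := by
  induction d with
  | zero => simp
  | succ d ih =>
    have h1 := ribbonCell_succ_of_mem (mem_of_col_eq h (i := k + d) (by omega) (by omega))
    have h2 := ih (by omega)
    rw [← add_assoc k d 1]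
    omega

theorem isSkewDiagram_ribbonDiagram (n : ℕ) (S : Finset ℕ) :
    IsSkewDiagram (ribbonDiagram n S) := by
  refine isSkewDiagram_of_ordConnected fun a ha b hb c hac hcb => ?_
  obtain ⟨k, hk, rfl⟩ := mem_ribbonDiagram.1 ha
  obtain ⟨l, hl, rfl⟩ := mem_ribbonDiagram.1 hb
  have h1 := hac.1
  have h2 := hac.2
  have h3 := hcb.1
  have h4 := hcb.2
  rw [mem_ribbonDiagram]
  -- Along the ribbon rows weakly decrease and columns weakly increase, so cells comparable in the
  -- product order share a row or a column, and c lies between them on it.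
  rcases le_total k l with hkl | hkl
  · have h5 := ribbonCell_row_antitone S hkl
    simp only at h5
    have hrow : (ribbonCell S k).1 = (ribbonCell S l).1 := by omega
    have h6 := ribbonCell_diagonal S k
    have h7 := ribbonCell_diagonal S l
    refine ⟨k + (c.2 - (ribbonCell S k).2), by omega, ?_⟩
    rw [ribbonCell_add_of_row_eq hrow (by omega)]
    exact Prod.ext (by simp only; omega) (by simp only; omega)
  · have h5 := ribbonCell_col_monotone S hkl
    simp only at h5
    have hcol : (ribbonCell S l).2 = (ribbonCell S k).2 := by omega
    have h6 := ribbonCell_diagonal S k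
    have h7 := ribbonCell_diagonal S l
    refine ⟨l + ((ribbonCell S l).1 - c.1), by omega, ?_⟩
    have h8 := ribbonCell_add_of_col_eq hcol (d := (ribbonCell S l).1 - c.1) (by omega)
    exact Prod.ext (by omega) (by omega)

theorem hasse_adj_iff (a b : ℕ × ℕ) : (SimpleGraph.hasse (ℕ × ℕ)).Adj a b ↔
    (a.1 = b.1 ∧ (a.2 + 1 = b.2 ∨ b.2 + 1 = a.2)) ∨
      (a.2 = b.2 ∧ (a.1 + 1 = b.1 ∨ b.1 + 1 = a.1)) := by
  obtain ⟨a1, a2⟩ := a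
  obtain ⟨b1, b2⟩ := b
  simp only [SimpleGraph.hasse_adj, Prod.mk_covBy_mk_iff, Nat.covBy_iff_add_one_eq]
  omega

theorem ribbonCell_adj (S : Finset ℕ) (k : ℕ) :
    (SimpleGraph.hasse (ℕ × ℕ)).Adj (ribbonCell S k) (ribbonCell S (k + 1)) := by
  rw [hasse_adj_iff]
  by_cases h : k ∈ S
  · have := ribbonCell_succ_of_mem h; omega
  · have := ribbonCell_succ_of_notMem h; omega

theorem isConnectedDiagram_ribbonDiagram {n : ℕ} (hn : 1 ≤ n) (S : Finset ℕ) :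
    IsConnectedDiagram (ribbonDiagram n S) := by
  have hmem : ∀ k < n, ribbonCell S k ∈ (ribbonDiagram n S : Set (ℕ × ℕ)) :=
    fun k hk => mem_ribbonDiagram.2 ⟨k, hk, rfl⟩
  have hreach : ∀ k (hk : k < n), ((SimpleGraph.hasse (ℕ × ℕ)).induce
      (ribbonDiagram n S : Set (ℕ × ℕ))).Reachable ⟨ribbonCell S 0, hmem 0 (by omega)⟩
        ⟨ribbonCell S k, hmem k hk⟩ := by
    intro k
    induction k with
    | zero => intro _; exact SimpleGraph.Reachable.refl _
    | succ k ih =>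
      intro hk
      refine (ih (by omega)).trans (SimpleGraph.Adj.reachable ?_)
      exact ribbonCell_adj S k
  refine SimpleGraph.connected_iff_exists_forall_reachable _ |>.2
    ⟨⟨ribbonCell S 0, hmem 0 (by omega)⟩, ?_⟩
  rintro ⟨c, hc⟩
  obtain ⟨k, hk, rfl⟩ := mem_ribbonDiagram.1 hc
  exact hreach k hk

theorem isSkewHook_ribbonDiagram {n : ℕ} (hn : 1 ≤ n) {S : Finset ℕ}
    (hS : S ⊆ Finset.range (n - 1)) : IsSkewHook (ribbonDiagram n S) where
  skew := isSkewDiagram_ribbonDiagram n S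
  connected := isConnectedDiagram_ribbonDiagram hn S
  no_square := by
    -- Opposite corners of the square would lie on the same diagonal.
    rintro ⟨i, j, h1, -, -, h2⟩
    obtain ⟨k, -, hk⟩ := mem_ribbonDiagram.1 h1
    obtain ⟨l, -, hl⟩ := mem_ribbonDiagram.1 h2
    have h3 := ribbonCell_diagonal S k
    have h4 := ribbonCell_diagonal S l
    have h5 : k = l := by rw [hk] at h3; rw [hl] at h4; simp only at h3 h4; omega
    rw [h5, hl] at hk
    simp at hk
  row_zero := ⟨(ribbonCell S (n - 1)).2, mem_ribbonDiagram.2 ⟨n - 1, by omega,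
    Prod.ext (by simp [ribbonCell, numBelow_of_subset hS]) rfl⟩⟩
  col_zero := ⟨(ribbonCell S 0).1, mem_ribbonDiagram.2 ⟨0, by omega,
    Prod.ext rfl (by simp [ribbonCell])⟩⟩

/-- The lowest diagonal of the diagram is -|S|, so |S| is determined. Matching diagonals then
identifies the cells index by index, and S is read off from the steps. -/
theorem ribbonDiagram_injOn {n : ℕ} {S S' : Finset ℕ} (hS : S ⊆ Finset.range (n - 1))
    (hS' : S' ⊆ Finset.range (n - 1)) (h : ribbonDiagram n S = ribbonDiagram n S') : S = S' := by
  rcases Nat.eq_zero_or_pos n with rfl | hn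
  · rw [Finset.subset_empty.1 hS, Finset.subset_empty.1 hS']
  have hcard : ∀ S S' : Finset ℕ, ribbonDiagram n S ⊆ ribbonDiagram n S' →
      S.card ≤ S'.card := by
    intro S S' h
    obtain ⟨l, hl, hc⟩ := mem_ribbonDiagram.1 (h (mem_ribbonDiagram.2 ⟨0, hn, rfl⟩))
    have h1 := ribbonCell_diagonal S 0
    have h2 := ribbonCell_diagonal S' l
    rw [hc] at h2
    omega
  have hc : S.card = S'.card := le_antisymm (hcard _ _ h.subset) (hcard _ _ h.symm.subset)
  have hcell : ∀ k < n, ribbonCell S k = ribbonCell S' k := by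
    intro k hk
    obtain ⟨l, hl, hlk⟩ := mem_ribbonDiagram.1 (h.subset (mem_ribbonDiagram.2 ⟨k, hk, rfl⟩))
    have h1 := ribbonCell_diagonal S k
    have h2 := ribbonCell_diagonal S' l
    rw [hlk] at h2
    rw [← hlk]
    congr 1
    omega
  have hsub : ∀ S S' : Finset ℕ, S ⊆ Finset.range (n - 1) →
      (∀ k < n, ribbonCell S k = ribbonCell S' k) → S ⊆ S' := by
    intro S S' hS hcell k hk
    have h0 := Finset.mem_range.1 (hS hk)
    by_contra hk'
    have h1 := (ribbonCell_succ_of_mem hk).2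
    have h2 := (ribbonCell_succ_of_notMem hk').2
    rw [hcell k (by omega), hcell (k + 1) (by omega)] at h1
    omega
  exact Finset.Subset.antisymm (hsub S S' hS hcell) (hsub S' S hS' fun k hk => (hcell k hk).symm)

/-! ### Skew hooks are ribbons -/

/-- Between two distinct cells on a diagonal, convexity would force a 2 × 2 square. -/
theorem IsSkewHook.eq_of_diagonal_eq {D : Finset (ℕ × ℕ)} (hD : IsSkewHook D) {a b : ℕ × ℕ}
    (ha : a ∈ D) (hb : b ∈ D) (h : a.2 + b.1 = b.2 + a.1) : a = b := by
  wlog hab : a.1 ≤ b.1 generalizing a b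
  · exact (this hb ha h.symm (by omega)).symm
  rcases hab.eq_or_lt with h1 | h1
  · exact Prod.ext h1 (by omega)
  · obtain ⟨a1, a2⟩ := a
    obtain ⟨b1, b2⟩ := b
    simp only at h h1
    refine absurd ⟨a1, a2, ha, ?_, ?_, ?_⟩ hD.no_square <;>
      exact hD.skew.ordConnected ha hb (Prod.mk_le_mk.2 (by omega)) (Prod.mk_le_mk.2 (by omega))

/-- A walk from a to b inside D must at some point cross from the diagonal of a to the next one, and
a is the only cell of D from which it can do so. -/
theorem IsSkewHook.exists_next {D : Finset (ℕ × ℕ)} (hD : IsSkewHook D) {a b : ℕ × ℕ}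
    (ha : a ∈ D) (hb : b ∈ D) (h : a.2 + b.1 < b.2 + a.1) :
    ∃ c ∈ D, (c.1 + 1 = a.1 ∧ c.2 = a.2) ∨ (c.1 = a.1 ∧ c.2 = a.2 + 1) := by
  obtain ⟨w⟩ := hD.connected.preconnected ⟨a, ha⟩ ⟨b, hb⟩
  obtain ⟨e, -, he1, he2⟩ := w.exists_boundary_dart {c | c.1.2 + a.1 ≤ a.2 + c.1.1}
    (by change a.2 + a.1 ≤ a.2 + a.1; omega) (by change ¬ b.2 + a.1 ≤ a.2 + b.1; omega)
  have hadj := (hasse_adj_iff e.fst.1 e.snd.1).1 e.adj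
  change e.fst.1.2 + a.1 ≤ a.2 + e.fst.1.1 at he1
  change ¬ e.snd.1.2 + a.1 ≤ a.2 + e.snd.1.1 at he2
  have heq : e.fst.1 = a := hD.eq_of_diagonal_eq e.fst.2 ha (by omega)
  rw [heq] at hadj he1
  exact ⟨e.snd.1, e.snd.2, by omega⟩

/-- Starting on the lowest diagonal and applying `IsSkewHook.exists_next` traces out the whole hook.
-/
theorem IsSkewHook.exists_eq_ribbonDiagram {D : Finset (ℕ × ℕ)} (hD : IsSkewHook D) :
    1 ≤ D.card ∧ ∃ S ⊆ Finset.range (D.card - 1), D = ribbonDiagram D.card S := by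
  obtain ⟨j0, hj0⟩ := hD.row_zero
  obtain ⟨i0, hi0⟩ := hD.col_zero
  have hpos : 1 ≤ D.card := Finset.card_pos.2 ⟨_, hj0⟩
  refine ⟨hpos, ?_⟩
  set n := D.card with hn
  obtain ⟨a, ha, hmin⟩ := D.exists_min_image (fun c => (c.2 : ℤ) - c.1) ⟨_, hj0⟩
  have hex : ∀ k, ∃ c, k < n → c ∈ D ∧ c.2 + a.1 = a.2 + c.1 + k := by
    intro k
    induction k with
    | zero => exact ⟨a, fun _ => ⟨ha, by omega⟩⟩
    | succ k ih =>
      obtain ⟨c, hc⟩ := ih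
      by_cases hk : k + 1 < n
      swap
      · exact ⟨a, fun h => absurd h hk⟩
      obtain ⟨hc, hck⟩ := hc (by omega)
      by_cases hb : ∃ b ∈ D, c.2 + b.1 < b.2 + c.1
      · obtain ⟨b, hb, hlt⟩ := hb
        obtain ⟨e, he, hstep⟩ := hD.exists_next hc hb hlt
        exact ⟨e, fun _ => ⟨he, by omega⟩⟩
      -- If no cell lies further on, D meets at most k+1 diagonals, once each, contradicting k+1 <
      -- n.
      · push Not at hb
        exfalso
        have hcard : D.card ≤ (Finset.range (k + 1)).card := by
          refine Finset.card_le_card_of_injOn (fun b => b.2 + a.1 - (a.2 + b.1)) ?_ ?_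
          · intro b hbD
            have h1 := hmin b hbD
            have h2 := hb b hbD
            simp only [Finset.coe_range, Set.mem_Iio]
            omega
          · intro b hbD e heD hbe
            have h1 := hmin b hbD
            have h2 := hmin e heD
            simp only at hbe
            exact hD.eq_of_diagonal_eq hbD heD (by omega)
        rw [Finset.card_range] at hcard
        omega
  choose p hp using hex
  have hstep : ∀ k, k + 1 < n → ((p (k + 1)).1 + 1 = (p k).1 ∧ (p (k + 1)).2 = (p k).2) ∨
      ((p (k + 1)).1 = (p k).1 ∧ (p (k + 1)).2 = (p k).2 + 1) := by
    intro k hk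
    have h1 := hp k (by omega)
    have h2 := hp (k + 1) hk
    obtain ⟨c, hc, hcs⟩ := hD.exists_next h1.1 h2.1 (by omega)
    rw [hD.eq_of_diagonal_eq h2.1 hc (by omega)]
    exact hcs
  have himage : (Finset.range n).image p = D := by
    apply Finset.eq_of_subset_of_card_le
    · intro c hc
      obtain ⟨k, hk, rfl⟩ := Finset.mem_image.1 hc
      exact (hp k (Finset.mem_range.1 hk)).1
    · rw [Finset.card_image_of_injOn, Finset.card_range]
      intro k hk l hl hkl
      have h1 := hp k (by simpa using hk)
      have h2 := hp l (by simpa using hl)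
      rw [show p k = p l from hkl] at h1
      omega
  let S := (Finset.range (n - 1)).filter fun k => (p (k + 1)).1 + 1 = (p k).1
  have hS : S ⊆ Finset.range (n - 1) := Finset.filter_subset _ _
  have hpos : ∀ k < n, (p k).1 + numBelow S k = (p 0).1 ∧
      (p k).2 + numBelow S k = (p 0).2 + k := by
    intro k
    induction k with
    | zero => intro _; simp [numBelow_zero]
    | succ k ih =>
      intro hk
      have h1 := ih (by omega)
      have h2 := hstep k hk
      by_cases hkS : k ∈ S
      · have h3 := (Finset.mem_filter.1 hkS).2
        rw [numBelow_succ_of_mem hkS]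
        omega
      · have h3 : ¬ (p (k + 1)).1 + 1 = (p k).1 := fun h =>
          hkS (Finset.mem_filter.2 ⟨Finset.mem_range.2 (by omega), h⟩)
        rw [numBelow_succ_of_notMem hkS]
        omega
  have hidx : ∀ c ∈ D, ∃ k < n, p k = c := by
    intro c hc
    rw [← himage] at hc
    simpa using hc
  -- The cells in row 0 and column 0 fix the translation: the path must start in row |S| and column
  -- 0.
  obtain ⟨k1, hk1, hpk1⟩ := hidx _ hj0
  obtain ⟨k2, hk2, hpk2⟩ := hidx _ hi0
  have h1 := (hpos k1 hk1).1
  have h2 := (hpos k2 hk2).2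
  have h3 := (hpos (n - 1) (by omega)).1
  rw [hpk1] at h1
  rw [hpk2] at h2
  rw [numBelow_of_subset hS] at h3
  have h4 := numBelow_le_card S k1
  have h5 := numBelow_le S k2
  simp only at h1 h2
  refine ⟨S, hS, himage.symm.trans (Finset.image_congr fun k hk => ?_)⟩
  have h6 := hpos k (by simpa using hk)
  have h7 := numBelow_le S k
  exact Prod.ext (by simp only [ribbonCell]; omega) (by simp only [ribbonCell]; omega)

/-! ### Column sizes of ribbons -/

theorem image_ribbonCell_col (S : Finset ℕ) (k : ℕ) :
    (Finset.range (k + 1)).image (fun i => (ribbonCell S i).2) =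
      Finset.range ((ribbonCell S k).2 + 1) := by
  induction k with
  | zero => simp [ribbonCell]
  | succ k ih =>
    rw [Finset.range_add_one, Finset.image_insert, ih]
    ext j
    simp only [Finset.mem_insert, Finset.mem_range]
    by_cases h : k ∈ S
    · have := (ribbonCell_succ_of_mem h).2; omega
    · have := (ribbonCell_succ_of_notMem h).2; omega

theorem columns_ribbonDiagram {n : ℕ} (hn : 1 ≤ n) {S : Finset ℕ}
    (hS : S ⊆ Finset.range (n - 1)) : columns (ribbonDiagram n S) = Finset.range (n - S.card) := by
  have h1 := image_ribbonCell_col S (n - 1)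
  have h2 := numBelow_of_subset hS
  have h3 := numBelow_le S (n - 1)
  rw [Nat.sub_add_cancel hn] at h1
  rw [columns, ribbonDiagram, Finset.image_image]
  refine h1.trans ?_
  congr 1
  simp only [ribbonCell]
  omega

/-- Counting cells by columns, n is the number of columns, n - |S|, plus the number of columns of
size 2. -/
theorem card_filter_colSize_two {n : ℕ} (hn : 1 ≤ n) {S : Finset ℕ}
    (hS : S ⊆ Finset.range (n - 1))
    (h : ∀ j ∈ columns (ribbonDiagram n S), colSize (ribbonDiagram n S) j ≠ 2 →
      colSize (ribbonDiagram n S) j = 1) :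
    ((columns (ribbonDiagram n S)).filter fun j => colSize (ribbonDiagram n S) j = 2).card =
      S.card := by
  have h1 := Finset.card_eq_sum_card_image Prod.snd (ribbonDiagram n S)
  rw [card_ribbonDiagram] at h1
  have h2 : ∀ j ∈ columns (ribbonDiagram n S), colSize (ribbonDiagram n S) j =
      1 + if colSize (ribbonDiagram n S) j = 2 then 1 else 0 := by
    intro j hj
    split_ifs with hc
    · exact hc
    · exact h j hj hc
  have h3 : n = ∑ j ∈ columns (ribbonDiagram n S), _ := h1.trans (Finset.sum_congr rfl h2)
  rw [Finset.sum_add_distrib, Finset.sum_const, ← Finset.card_filter,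
    columns_ribbonDiagram hn hS, Finset.card_range] at h3
  rw [columns_ribbonDiagram hn hS]
  have h4 := Finset.card_le_card hS
  rw [Finset.card_range] at h4
  simp only [smul_eq_mul, mul_one] at h3
  omega

theorem mem_filter_col {n : ℕ} {S : Finset ℕ} {c : ℕ × ℕ} {j : ℕ} :
    c ∈ (ribbonDiagram n S).filter (fun c => c.2 = j) ↔
      ∃ k < n, ribbonCell S k = c ∧ (ribbonCell S k).2 = j := by
  rw [Finset.mem_filter, mem_ribbonDiagram]
  constructor
  · rintro ⟨⟨k, hk, rfl⟩, h⟩; exact ⟨k, hk, rfl, h⟩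
  · rintro ⟨k, hk, rfl, h⟩; exact ⟨⟨k, hk, rfl⟩, h⟩

theorem card_le_colSize {n : ℕ} {S I : Finset ℕ} {j : ℕ}
    (hI : ∀ i ∈ I, i < n ∧ (ribbonCell S i).2 = j) : I.card ≤ colSize (ribbonDiagram n S) j := by
  rw [colSize, ← Finset.card_image_of_injective I (ribbonCell_injective S)]
  refine Finset.card_le_card fun c hc => ?_
  obtain ⟨i, hi, rfl⟩ := Finset.mem_image.1 hc
  exact mem_filter_col.2 ⟨i, (hI i hi).1, rfl, (hI i hi).2⟩

theorem colSize_le_card {n : ℕ} {S I : Finset ℕ} {j : ℕ}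
    (hI : ∀ i < n, (ribbonCell S i).2 = j → i ∈ I) : colSize (ribbonDiagram n S) j ≤ I.card := by
  rw [colSize]
  refine (Finset.card_le_card fun c hc => ?_).trans (Finset.card_image_le (f := ribbonCell S))
  obtain ⟨k, hk, rfl, h⟩ := mem_filter_col.1 hc
  exact Finset.mem_image_of_mem _ (hI k hk h)

/-- Columns are maximal runs of up steps: two consecutive elements of S give three cells in a
column, and n-2 ∈ S gives two cells in the last one. -/
theorem isHookNK_ribbonDiagram_iff {n k : ℕ} (hn : 1 ≤ n) {S : Finset ℕ}
    (hS : S ⊆ Finset.range (n - 1)) :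
    IsHookNK n k (ribbonDiagram n S) ↔ IsSparse n S ∧ S.card = k := by
  have hmem : ∀ i < n, (ribbonCell S i).2 ∈ columns (ribbonDiagram n S) := fun i hi =>
    Finset.mem_image_of_mem _ (mem_ribbonDiagram.2 ⟨i, hi, rfl⟩)
  have hmem' : ∀ j ∈ columns (ribbonDiagram n S), ∃ i < n, (ribbonCell S i).2 = j := by
    intro j hj
    obtain ⟨c, hc, rfl⟩ := Finset.mem_image.1 hj
    obtain ⟨i, hi, rfl⟩ := mem_ribbonDiagram.1 hc
    exact ⟨i, hi, rfl⟩
  constructor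
  · intro h
    refine ⟨fun i hi => ?_, ?_⟩
    · have hin := Finset.mem_range.1 (hS hi)
      have h1 := (ribbonCell_succ_of_mem hi).2
      have hlast : i + 2 < n := by
        by_contra hc
        have h2 : ∀ l ∈ ({i, i + 1} : Finset ℕ), l < n ∧
            (ribbonCell S l).2 = (ribbonCell S i).2 := by
          intro l hl
          simp only [Finset.mem_insert, Finset.mem_singleton] at hl
          rcases hl with rfl | rfl
          · exact ⟨by omega, rfl⟩
          · exact ⟨by omega, h1⟩
        have h3 := card_le_colSize h2
        rw [h.last _ (hmem i (by omega)), Finset.card_pair (by omega)] at h3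
        · omega
        · intro j hj
          obtain ⟨l, hl, rfl⟩ := hmem' j hj
          rw [← h1]
          exact ribbonCell_col_monotone S (by omega)
      refine ⟨hlast, fun hi' => ?_⟩
      have h2 := (ribbonCell_succ_of_mem hi').2
      have h3 : ∀ l ∈ ({i, i + 1, i + 1 + 1} : Finset ℕ), l < n ∧
          (ribbonCell S l).2 = (ribbonCell S i).2 := by
        intro l hl
        simp only [Finset.mem_insert, Finset.mem_singleton] at hl
        rcases hl with rfl | rfl | rfl
        · exact ⟨by omega, rfl⟩
        · exact ⟨by omega, h1⟩
        · exact ⟨by omega, h2.trans h1⟩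
      have h4 := card_le_colSize h3
      rw [Finset.card_eq_three.2 ⟨i, i + 1, i + 1 + 1, by omega, by omega, by omega, rfl⟩] at h4
      have h5 := h.other _ (hmem i (by omega)) (by omega)
      omega
    · rw [← card_filter_colSize_two hn hS h.other]
      exact h.size_two
  · rintro ⟨hsp, rfl⟩
    have hother : ∀ j ∈ columns (ribbonDiagram n S), colSize (ribbonDiagram n S) j ≠ 2 →
        colSize (ribbonDiagram n S) j = 1 := by
      intro j hj hne
      have hex := hmem' j hj
      classical
      -- Let i be the first index in column j; by sparseness only i and i+1 can lie there.
      obtain ⟨h1, h2⟩ := Nat.find_spec hex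
      set i := Nat.find hex
      have h3 := card_le_colSize (n := n) (S := S) (I := {i}) (j := j) (by simp [h1, h2])
      have h4 := colSize_le_card (n := n) (S := S) (I := {i, i + 1}) (j := j) (by
        intro l hl hlj
        have h5 : i ≤ l := Nat.find_min' hex ⟨hl, hlj⟩
        have h6 : ¬ i + 2 ≤ l := fun hc => (hsp i (mem_of_col_eq (h2.trans hlj.symm) le_rfl
          (by omega))).2 (mem_of_col_eq (h2.trans hlj.symm) (by omega) (by omega))
        simp only [Finset.mem_insert, Finset.mem_singleton]
        omega)
      rw [Finset.card_singleton] at h3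
      rw [Finset.card_pair (by omega)] at h4
      omega
    refine ⟨isSkewHook_ribbonDiagram hn hS, card_ribbonDiagram n S,
      card_filter_colSize_two hn hS hother, hother, fun j hj hmax => ?_⟩
    have hjn : (ribbonCell S (n - 1)).2 = j := by
      obtain ⟨l, hl, rfl⟩ := hmem' j hj
      exact le_antisymm (hmax _ (hmem _ (by omega))) (ribbonCell_col_monotone S (by omega))
    have h3 := card_le_colSize (n := n) (S := S) (I := {n - 1}) (j := j) (by simp [hjn]; omega)
    have h4 := colSize_le_card (n := n) (S := S) (I := {n - 1}) (j := j) (by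
      intro l hl hlj
      have : ¬ l < n - 1 := fun hc => by
        have := (hsp (n - 2) (mem_of_col_eq (hlj.trans hjn.symm) (by omega) (by omega))).1
        omega
      rw [Finset.mem_singleton]
      omega)
    rw [Finset.card_singleton] at h3 h4
    omega

/-! ### The γ-expansion -/

open Classical in
theorem gammaCoeff_eq {n : ℕ} (hn : 1 ≤ n) (k : ℕ) :
    gammaCoeff n k = ∑ S ∈ (Finset.range (n - 1)).powerset with IsSparse n S ∧ S.card = k,
      ribbon n S := by
  symm
  refine Finset.sum_bij (fun S _ => ribbonDiagram n S) ?_ ?_ ?_ ?_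
  · intro S hS
    rw [Finset.mem_filter, Finset.mem_powerset] at hS
    rw [hooks, Set.Finite.mem_toFinset]
    exact (isHookNK_ribbonDiagram_iff hn hS.1).2 hS.2
  · intro S hS S' hS' h
    rw [Finset.mem_filter, Finset.mem_powerset] at hS hS'
    exact ribbonDiagram_injOn hS.1 hS'.1 h
  · intro D hD
    rw [hooks, Set.Finite.mem_toFinset] at hD
    have hD' : IsHookNK n k D := hD
    obtain ⟨-, S, hS, hDS⟩ := hD'.hook.exists_eq_ribbonDiagram
    rw [hD'.size] at hS hDS
    refine ⟨S, ?_, hDS.symm⟩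
    rw [Finset.mem_filter, Finset.mem_powerset]
    rw [hDS] at hD'
    exact ⟨hS, (isHookNK_ribbonDiagram_iff hn hS).1 hD'⟩
  · intro S _
    exact (skewSchur_ribbonDiagram n S).symm

theorem sparseSum_eq_sum_gammaCoeff {n : ℕ} (hn : 1 ≤ n) :
    sparseSum n = ∑ k ∈ Finset.range ((n - 1) / 2 + 1),
      C (gammaCoeff n k) * X ^ k * (1 + X) ^ (n - 1 - 2 * k) := by
  classical
  simp only [gammaCoeff_eq hn, map_sum, Finset.sum_mul, Finset.sum_filter]
  rw [Finset.sum_comm, sparseSum]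
  refine Finset.sum_congr rfl fun S hS => ?_
  by_cases h : IsSparse n S
  · have := h.two_mul_card_le
    rw [Finset.sum_eq_single S.card]
    · rw [if_pos ⟨h, rfl⟩, sparseWeight, if_pos h]
      ring
    · intro k _ hk
      simp [hk.symm]
    · intro hk
      exact absurd (Finset.mem_range.2 (by omega)) hk
  · simp [h, sparseWeight]

/-! ### Row lengths as finitely supported functions -/

/-- Remove the first row. -/
def tailRows (p : ℕ →₀ ℕ) : ℕ →₀ ℕ := p.comapDomain Nat.succ Nat.succ_injective.injOn

@[simp] theorem tailRows_apply (p : ℕ →₀ ℕ) (i : ℕ) : tailRows p i = p (i + 1) := rfl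

/-- Put a row of length `a` on top. -/
def consRow (a : ℕ) (p : ℕ →₀ ℕ) : ℕ →₀ ℕ := Finsupp.single 0 a + p.mapDomain Nat.succ

@[simp] theorem consRow_zero (a : ℕ) (p : ℕ →₀ ℕ) : consRow a p 0 = a := by
  rw [consRow, Finsupp.add_apply, Finsupp.mapDomain_of_notMem_range _ _ (by simp)]
  simp

@[simp] theorem consRow_succ (a : ℕ) (p : ℕ →₀ ℕ) (i : ℕ) : consRow a p (i + 1) = p i := by
  rw [consRow, Finsupp.add_apply, ← Nat.succ_eq_add_one,
    Finsupp.mapDomain_apply Nat.succ_injective]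
  simp

theorem tailRows_consRow (a : ℕ) (p : ℕ →₀ ℕ) : tailRows (consRow a p) = p := by
  ext i; simp

theorem consRow_tailRows (p : ℕ →₀ ℕ) : consRow (p 0) (tailRows p) = p := by
  ext i; rcases i with _ | i <;> simp

theorem degree_consRow (a : ℕ) (p : ℕ →₀ ℕ) : (consRow a p).degree = a + p.degree := by
  rw [consRow, map_add, Finsupp.degree_single, Finsupp.degree_mapDomain]

theorem degree_tailRows (p : ℕ →₀ ℕ) : p 0 + (tailRows p).degree = p.degree := by
  rw [← degree_consRow, consRow_tailRows]

theorem degree_sub {p q : ℕ →₀ ℕ} (h : q ≤ p) : (p - q).degree + q.degree = p.degree := by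
  rw [← map_add, tsub_add_cancel_of_le h]

/-- The cells of the diagram with row lengths `p`. -/
def rowCells (p : ℕ →₀ ℕ) : Finset (ℕ × ℕ) :=
  (p.support.sigma fun i => Finset.range (p i)).map (Equiv.sigmaEquivProd ℕ ℕ).toEmbedding

@[simp] theorem mem_rowCells {p : ℕ →₀ ℕ} {c : ℕ × ℕ} : c ∈ rowCells p ↔ c.2 < p c.1 := by
  obtain ⟨i, j⟩ := c
  simp only [rowCells, Finset.mem_map_equiv, Finset.mem_sigma, Finsupp.mem_support_iff,
    Finset.mem_range]
  change p i ≠ 0 ∧ j < p i ↔ j < p i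
  omega

theorem card_rowCells (p : ℕ →₀ ℕ) : (rowCells p).card = p.degree := by
  rw [rowCells, Finset.card_map, Finset.card_sigma]
  simp [Finsupp.degree_apply]

theorem rowCells_subset {p q : ℕ →₀ ℕ} (h : q ≤ p) : rowCells q ⊆ rowCells p := fun c hc => by
  have := h c.1
  rw [mem_rowCells] at hc ⊢
  omega

/-! ### Schur functions in finitely many variables -/

/-- Semistandard fillings of the diagram with row lengths `p` with entries below `N`. -/
def tableaux (N : ℕ) (p : ℕ →₀ ℕ) : Set (rowCells p → ℕ) :=
  {T | IsSemistandard (rowCells p) T ∧ ∀ c, T c < N}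

/-- The Schur function in the variables `x_0, …, x_{N-1}`. -/
def tabSeries (N : ℕ) (p : ℕ →₀ ℕ) : Ser := genSeries (tableaux N p) letterCount

theorem exists_threshold (n : ℕ) (P : ℕ → Prop) (hP : ∀ i j, i ≤ j → j < n → P j → P i) :
    ∃ k ≤ n, ∀ j < n, (P j ↔ j < k) := by
  classical
  have hex : ∃ k, k = n ∨ ¬ P k := ⟨n, Or.inl rfl⟩
  refine ⟨Nat.find hex, Nat.find_min' hex (Or.inl rfl), fun j hj => ⟨fun h => ?_, fun h => ?_⟩⟩
  · by_contra hc
    push Not at hc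
    rcases Nat.find_spec hex with h1 | h1
    · omega
    · exact h1 (hP _ j hc hj h)
  · have := Nat.find_min hex h
    push Not at this
    exact this.2

/-- Weakly increasing rows make the cells with entries below N left-justified. A cell with another
one below it has an entry below N by strictness of columns, hence the lower bound `tailRows p`. -/
theorem exists_rows_lt {N : ℕ} {p : ℕ →₀ ℕ} {T : rowCells p → ℕ} (hT : T ∈ tableaux (N + 1) p)
    (hp : Antitone p) :
    ∃ q ∈ Finset.Icc (tailRows p) p, ∀ c, T c < N ↔ c.1 ∈ rowCells q := by
  have h1 : ∀ i, ∃ k ≤ p i, ∀ j < p i,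
      ((∃ h : (i, j) ∈ rowCells p, T ⟨(i, j), h⟩ < N) ↔ j < k) := by
    intro i
    refine exists_threshold _ _ fun j j' hjj' hj' hlt => ?_
    obtain ⟨h, hlt⟩ := hlt
    have hj : (i, j) ∈ rowCells p := by rw [mem_rowCells]; exact hjj'.trans_lt hj'
    refine ⟨hj, ?_⟩
    rcases hjj'.eq_or_lt with rfl | hjj'
    · exact hlt
    · exact (hT.1.row_weak ⟨(i, j), hj⟩ ⟨(i, j'), h⟩ rfl hjj').trans_lt hlt
  choose q hqp hq using h1
  refine ⟨Finsupp.onFinset p.support q fun i hi => ?_, ?_, ?_⟩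
  · rw [Finsupp.mem_support_iff]
    have := hqp i
    omega
  · rw [Finset.mem_Icc]
    refine ⟨fun i => ?_, hqp⟩
    rw [tailRows_apply, Finsupp.onFinset_apply]
    by_contra hc
    push Not at hc
    have h2 : (i + 1, q i) ∈ rowCells p := by rw [mem_rowCells]; exact hc
    have h3 : q i < p i := hc.trans_le (hp (Nat.le_succ i))
    have h4 : (i, q i) ∈ rowCells p := by rw [mem_rowCells]; exact h3
    have h5 := hT.1.col_strict ⟨_, h4⟩ ⟨_, h2⟩ rfl (Nat.lt_succ_self i)
    have h6 := hT.2 ⟨_, h2⟩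
    exact lt_irrefl _ ((hq i (q i) h3).1 ⟨h4, by omega⟩)
  · rintro ⟨⟨i, j⟩, hc⟩
    rw [mem_rowCells] at hc
    rw [mem_rowCells, Finsupp.onFinset_apply, ← hq i j hc]
    exact ⟨fun h => ⟨_, h⟩, fun ⟨_, h⟩ => h⟩

theorem letterCount_eq_add {N : ℕ} {p q : ℕ →₀ ℕ} (hqp : q ≤ p) {T : rowCells p → ℕ}
    (hN : ∀ c, c.1 ∉ rowCells q → T c = N) :
    letterCount T = Finsupp.single N (p.degree - q.degree) +
      letterCount fun c : rowCells q => T ⟨c.1, rowCells_subset hqp c.2⟩ := by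
  classical
  have hsub := rowCells_subset hqp
  -- Extension by zero lets the sums over the two subtypes be compared inside ℕ × ℕ.
  let F : ℕ × ℕ → ℕ →₀ ℕ := fun c => if h : c ∈ rowCells p then Finsupp.single (T ⟨c, h⟩) 1 else 0
  have h1 : letterCount T = ∑ c ∈ rowCells p, F c := by
    rw [letterCount, ← Finset.sum_coe_sort (rowCells p) F]
    refine Finset.sum_congr rfl fun c _ => ?_
    simp only [F, dif_pos c.2]
  have h2 : (letterCount fun c : rowCells q => T ⟨c.1, hsub c.2⟩) = ∑ c ∈ rowCells q, F c := by
    rw [letterCount, ← Finset.sum_coe_sort (rowCells q) F]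
    refine Finset.sum_congr rfl fun c _ => ?_
    simp only [F, dif_pos (hsub c.2)]
  rw [h1, h2, ← Finset.sum_sdiff hsub]
  congr 1
  rw [Finset.sum_congr rfl (g := fun _ => Finsupp.single N 1), Finset.sum_const,
    Finset.card_sdiff_of_subset hsub, card_rowCells, card_rowCells]
  · simp
  · intro c hc
    rw [Finset.mem_sdiff] at hc
    simp only [F, dif_pos hc.1, hN ⟨c, hc.1⟩ hc.2]

theorem genSeries_singleton (m : ℕ →₀ ℕ) :
    genSeries ({()} : Set Unit) (fun _ => m) = MvPowerSeries.monomial m (1 : ℝ) := by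
  classical
  ext m'
  rw [coeff_genSeries, MvPowerSeries.coeff_monomial]
  split_ifs with h
  · subst h; simp
  · simp [Ne.symm h]

/-- The branching rule: deleting the cells with the largest entry N removes a horizontal strip,
which is what membership of q in the interval expresses, and every filling of q extends back
uniquely. -/
theorem tabSeries_succ (N : ℕ) {p : ℕ →₀ ℕ} (hp : Antitone p) :
    tabSeries (N + 1) p = ∑ q ∈ Finset.Icc (tailRows p) p,
      (MvPowerSeries.X N : Ser) ^ (p.degree - q.degree) * tabSeries N q := by
  rw [tabSeries, genSeries_iUnion (finiteFibers_letterCount _) (Finset.Icc (tailRows p) p)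
    (fun q => {T | T ∈ tableaux (N + 1) p ∧ ∀ c, T c < N ↔ c.1 ∈ rowCells q})]
  · refine Finset.sum_congr rfl fun q hq => ?_
    rw [Finset.mem_Icc] at hq
    have hsub := rowCells_subset hq.2
    rw [MvPowerSeries.X_pow_eq, ← genSeries_singleton, tabSeries,
      genSeries_mul (fun m => Set.toFinite _) (finiteFibers_letterCount _)]
    have hN : ∀ T ∈ {T | T ∈ tableaux (N + 1) p ∧ ∀ c, T c < N ↔ c.1 ∈ rowCells q},
        ∀ c, c.1 ∉ rowCells q → T c = N := by
      intro T hT c hc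
      have h1 := hT.1.2 c
      have h2 := (hT.2 c).not.2 hc
      omega
    refine genSeries_congr (fun T => ((), fun c : rowCells q => T ⟨c.1, hsub c.2⟩)) ⟨?_, ?_, ?_⟩ ?_
    · rintro T ⟨hT, hTq⟩
      refine ⟨rfl, ⟨⟨fun a b h1 h2 => hT.1.row_weak _ _ h1 h2,
        fun a b h1 h2 => hT.1.col_strict _ _ h1 h2⟩, fun c => (hTq _).2 c.2⟩⟩
    · intro T hT T' hT' h
      funext c
      by_cases hc : c.1 ∈ rowCells q
      · exact congrFun (congrArg Prod.snd h) ⟨c.1, hc⟩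
      · rw [hN T hT c hc, hN T' hT' c hc]
    · rintro ⟨_, U⟩ ⟨-, hU⟩
      classical
      let T : rowCells p → ℕ := fun c => if h : c.1 ∈ rowCells q then U ⟨c.1, h⟩ else N
      have hT1 : ∀ c (h : c.1 ∈ rowCells q), T c = U ⟨c.1, h⟩ := fun c h => dif_pos h
      have hT2 : ∀ c, c.1 ∉ rowCells q → T c = N := fun c h => dif_neg h
      have hle : ∀ c, T c ≤ N := fun c => by
        by_cases h : c.1 ∈ rowCells q
        · rw [hT1 c h]; exact (hU.2 _).le
        · exact (hT2 c h).le
      refine ⟨T, ⟨⟨⟨fun a b h1 h2 => ?_, fun a b h1 h2 => ?_⟩, fun c => by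
        have := hle c; omega⟩, fun c => ?_⟩, ?_⟩
      · by_cases hb : b.1 ∈ rowCells q
        · have ha : a.1 ∈ rowCells q := by
            rw [mem_rowCells] at hb ⊢
            rw [h1]
            omega
          rw [hT1 a ha, hT1 b hb]
          exact hU.1.row_weak _ _ h1 h2
        · rw [hT2 b hb]
          exact hle a
      -- A cell with another one of p below it belongs to q, because `tailRows p ≤ q`.
      · have hb' := mem_rowCells.1 b.2
        have ha : a.1 ∈ rowCells q := by
          rw [mem_rowCells, h1]
          have h3 := hq.1 a.1.1
          have h4 := hp (show a.1.1 + 1 ≤ b.1.1 by omega)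
          rw [tailRows_apply] at h3
          omega
        by_cases hb : b.1 ∈ rowCells q
        · rw [hT1 a ha, hT1 b hb]
          exact hU.1.col_strict _ _ h1 h2
        · rw [hT1 a ha, hT2 b hb]
          exact hU.2 _
      · by_cases h : c.1 ∈ rowCells q
        · simp [hT1 c h, h, hU.2]
        · simp [hT2 c h, h]
      · refine Prod.ext rfl (funext fun c => ?_)
        exact hT1 _ c.2
    · intro T hT
      exact (letterCount_eq_add hq.2 (hN T hT)).symm
  · intro T
    constructor
    · intro hT
      obtain ⟨q, hq, h⟩ := exists_rows_lt hT hp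
      exact ⟨q, hq, hT, h⟩
    · rintro ⟨q, -, h⟩
      exact h.1
  · intro q hq r hr T hTq hTr
    rw [Finset.mem_Icc] at hq hr
    have key : ∀ q r : ℕ →₀ ℕ, q ≤ p → (∀ c : rowCells p, c.1 ∈ rowCells q → c.1 ∈ rowCells r) →
        q ≤ r := by
      intro q r hqp h i
      by_contra hc
      push Not at hc
      have h1 := hqp i
      have h2 := h ⟨(i, r i), by rw [mem_rowCells]; exact hc.trans_le h1⟩
        (by rw [mem_rowCells]; exact hc)
      rw [mem_rowCells] at h2
      exact lt_irrefl _ h2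
    exact le_antisymm (key q r hq.2 fun c hc => (hTr.2 c).1 ((hTq.2 c).2 hc))
      (key r q hr.2 fun c hc => (hTq.2 c).1 ((hTr.2 c).2 hc))

theorem tabSeries_zero (p : ℕ →₀ ℕ) : tabSeries 0 p = if p = 0 then 1 else 0 := by
  classical
  ext m
  rw [tabSeries, coeff_genSeries]
  split_ifs with h
  · subst h
    have : IsEmpty (rowCells 0) := ⟨fun c => by have := mem_rowCells.1 c.2; simp at this⟩
    rw [MvPowerSeries.coeff_one]
    have h1 : ∀ T : rowCells 0 → ℕ, T ∈ tableaux 0 0 :=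
      fun T => ⟨⟨fun a => isEmptyElim a, fun a => isEmptyElim a⟩, fun a => isEmptyElim a⟩
    have h2 : ∀ T : rowCells 0 → ℕ, letterCount T = 0 := fun T => by simp [letterCount]
    simp only [h1, h2, true_and, eq_comm (a := m)]
    split_ifs with hm
    · rw [Set.ncard_eq_one.2 ⟨isEmptyElim, by ext; simp [hm, eq_iff_true_of_subsingleton]⟩]; simp
    · simp [hm]
  · have hne : (tableaux 0 p) = ∅ := by
      rw [Set.eq_empty_iff_forall_notMem]
      intro T hT
      obtain ⟨i, hi⟩ := Finsupp.ne_iff.1 h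
      have hc : (i, 0) ∈ rowCells p := by
        rw [mem_rowCells]; exact Nat.pos_of_ne_zero hi
      exact absurd (hT.2 ⟨_, hc⟩) (Nat.not_lt_zero _)
    simp [hne]

/-! ### The Pieri rule -/

/-- The row lengths obtained from `p` by adding a horizontal strip of size `r`. -/
def addStrip (r : ℕ) (p : ℕ →₀ ℕ) : Finset (ℕ →₀ ℕ) :=
  {q ∈ Finset.Icc p (consRow (p 0 + r) p) | q.degree = p.degree + r}

/-- The bound on row 0 in the definition only makes the set finite; it follows from the degree
condition. -/
theorem mem_addStrip {r : ℕ} {p q : ℕ →₀ ℕ} :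
    q ∈ addStrip r p ↔ p ≤ q ∧ tailRows q ≤ p ∧ q.degree = p.degree + r := by
  rw [addStrip, Finset.mem_filter, Finset.mem_Icc]
  constructor
  · rintro ⟨⟨h1, h2⟩, h3⟩
    exact ⟨h1, fun i => (h2 (i + 1)).trans_eq (consRow_succ _ _ i), h3⟩
  · rintro ⟨h1, h2, h3⟩
    refine ⟨⟨h1, fun i => ?_⟩, h3⟩
    rcases i with _ | i
    · rw [consRow_zero]
      have h4 := degree_sub h1
      have h5 := Finsupp.le_degree 0 (q - p)
      rw [Finsupp.tsub_apply] at h5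
      omega
    · rw [consRow_succ]
      exact h2 i

theorem antitone_of_mem_addStrip {r : ℕ} {p q : ℕ →₀ ℕ} (h : q ∈ addStrip r p) :
    Antitone q := by
  rw [mem_addStrip] at h
  exact antitone_nat_of_succ_le fun i => (h.2.1 i).trans (h.1 i)

theorem antitone_of_mem_Icc {p q : ℕ →₀ ℕ} (h : q ∈ Finset.Icc (tailRows p) p) : Antitone q := by
  rw [Finset.mem_Icc] at h
  exact antitone_nat_of_succ_le fun i => (h.2 (i + 1)).trans (h.1 i)

theorem tabSeries_single_succ (N r : ℕ) :
    tabSeries (N + 1) (Finsupp.single 0 r) = ∑ j ∈ Finset.range (r + 1),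
      (MvPowerSeries.X N : Ser) ^ j * tabSeries N (Finsupp.single 0 (r - j)) := by
  have hanti : Antitone (Finsupp.single 0 r : ℕ →₀ ℕ) := by
    refine antitone_nat_of_succ_le fun i => ?_
    simp
  rw [tabSeries_succ N hanti]
  have htail : tailRows (Finsupp.single 0 r) = 0 := by ext i; simp
  symm
  refine Finset.sum_bij' (fun j _ => Finsupp.single 0 (r - j)) (fun q _ => r - q 0) ?_ ?_ ?_ ?_ ?_
  · intro j hj
    rw [htail, Finset.mem_Icc]
    exact ⟨bot_le, Finsupp.single_mono (Nat.sub_le _ _)⟩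
  · intro q hq
    simp only [Finset.mem_range]
    omega
  · intro j hj
    have := Finset.mem_range.1 hj
    simp only [Finsupp.single_eq_same]
    omega
  · intro q hq
    rw [Finset.mem_Icc] at hq
    ext i
    have h1 := hq.2 i
    rcases i with _ | i
    · simp at h1 ⊢; omega
    · simp at h1 ⊢; omega
  · intro j hj
    have := Finset.mem_range.1 hj
    rw [Finsupp.degree_single, Finsupp.degree_single, show r - (r - j) = j by omega]

/-- The local rule: for fixed `p`, `q`, the ways to add horizontal strips to `p` and `q` with
the same result correspond to the ways to remove them with the same result, together with a number
of additional cells in the first row. -/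
theorem sum_add_remove_strips {M : Type*} [AddCommMonoid M] (r : ℕ) {p : ℕ →₀ ℕ}
    (F : ℕ → (ℕ →₀ ℕ) → M) :
    ∑ s ∈ addStrip r p, ∑ q ∈ Finset.Icc (tailRows s) s, F (s.degree - q.degree) q =
      ∑ u ∈ Finset.Icc (tailRows p) p, ∑ j ∈ Finset.range (r + 1), ∑ q ∈ addStrip (r - j) u,
        F (p.degree - u.degree + j) q := by
  rw [Finset.sum_sigma', Finset.sum_sigma', Finset.sum_sigma']
  have hdeg : ∀ q : ℕ →₀ ℕ, (q ⊓ p).degree + (q ⊔ p).degree = q.degree + p.degree := by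
    intro q
    rw [← map_add, ← map_add]
    congr 1
    ext i
    simp only [Finsupp.add_apply, Finsupp.inf_apply, Finsupp.sup_apply]
    omega
  have hforth : ∀ s q : ℕ →₀ ℕ, s ∈ addStrip r p → q ∈ Finset.Icc (tailRows s) s →
      q ⊔ p ≤ s ∧ tailRows s ≤ q ⊓ p := by
    intro s q hs hq
    rw [mem_addStrip] at hs
    rw [Finset.mem_Icc] at hq
    exact ⟨sup_le hq.2 hs.1, le_inf hq.1 hs.2.1⟩
  have htail : ∀ q s : ℕ →₀ ℕ, q ≤ s → tailRows q ≤ tailRows s := fun q s h i => h (i + 1)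
  have hback : ∀ u q : ℕ →₀ ℕ, ∀ j, u ∈ Finset.Icc (tailRows p) p → q ∈ addStrip (r - j) u →
      u ≤ q ⊓ p ∧ tailRows (q ⊔ p) ≤ u := by
    intro u q j hu hq
    rw [mem_addStrip] at hq
    rw [Finset.mem_Icc] at hu
    exact ⟨le_inf hq.1 hu.2, fun i => sup_le (hq.2.1 i) (hu.1 i)⟩
  have hdf : ∀ s q : ℕ →₀ ℕ, s ∈ addStrip r p → q ∈ Finset.Icc (tailRows s) s →
      (q ⊓ p + tailRows (q ⊔ p) - tailRows s).degree + (tailRows s).degree =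
        (q ⊓ p).degree + (tailRows (q ⊔ p)).degree := by
    intro s q hs hq
    rw [degree_sub ((hforth s q hs hq).2.trans le_self_add), map_add]
  have hdb : ∀ u q : ℕ →₀ ℕ, ∀ j, u ∈ Finset.Icc (tailRows p) p → q ∈ addStrip (r - j) u →
      (q ⊓ p + tailRows (q ⊔ p) - u).degree + u.degree =
        (q ⊓ p).degree + (tailRows (q ⊔ p)).degree := by
    intro u q j hu hq
    rw [degree_sub ((hback u q j hu hq).1.trans le_self_add), map_add]
  have hfacts : ∀ s q : ℕ →₀ ℕ, s ∈ addStrip r p → q ∈ Finset.Icc (tailRows s) s →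
      (q ⊔ p) 0 ≤ s 0 ∧ s 0 - (q ⊔ p) 0 ≤ r ∧
      q.degree = (q ⊓ p + tailRows (q ⊔ p) - tailRows s).degree + (r - (s 0 - (q ⊔ p) 0)) ∧
      s.degree = p.degree + r ∧ q.degree ≤ s.degree ∧
      (q ⊓ p + tailRows (q ⊔ p) - tailRows s).degree ≤ p.degree := by
    intro s q hs hq
    have h1 := hforth s q hs hq
    have h2 := hdf s q hs hq
    have h3 := hdeg q
    have h4 := degree_tailRows (q ⊔ p)
    have h5 := degree_tailRows s
    have h6 := (mem_addStrip.1 hs).2.2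
    have h7 : (tailRows (q ⊔ p)).degree ≤ (tailRows s).degree :=
      Finsupp.degree_mono (htail _ _ h1.1)
    have h8 : (q ⊓ p).degree ≤ q.degree := Finsupp.degree_mono inf_le_left
    have h10 : (q ⊓ p).degree ≤ p.degree := Finsupp.degree_mono inf_le_right
    have h9 := h1.1 0
    have h11 : q.degree ≤ s.degree := Finsupp.degree_mono (Finset.mem_Icc.1 hq).2
    omega
  -- For fixed p and q, both `s (i + 1)` and `u i` range over the interval from `(q ⊔ p) (i + 1)` to
  -- `(q ⊓ p) i`; the bijection reflects it. The excess of `s 0` over `(q ⊔ p) 0` becomes j.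
  refine Finset.sum_bij'
    (fun x _ => ⟨⟨x.2 ⊓ p + tailRows (x.2 ⊔ p) - tailRows x.1, x.1 0 - (x.2 ⊔ p) 0⟩, x.2⟩)
    (fun y _ => ⟨consRow ((y.2 ⊔ p) 0 + y.1.2) (y.2 ⊓ p + tailRows (y.2 ⊔ p) - y.1.1), y.2⟩)
    ?_ ?_ ?_ ?_ ?_
  · rintro ⟨s, q⟩ h
    simp only [Finset.mem_sigma] at h ⊢
    obtain ⟨hs, hq⟩ := h
    have h1 := hforth s q hs hq
    have h2 := hfacts s q hs hq
    refine ⟨⟨Finset.mem_Icc.2 ⟨fun i => ?_, fun i => ?_⟩, Finset.mem_range.2 (by omega)⟩,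
      mem_addStrip.2 ⟨fun i => ?_, fun i => ?_, h2.2.2.1⟩⟩
    all_goals
      have h3 := h1.1 i
      have h4 := h1.1 (i + 1)
      have h5 := h1.2 i
      simp only [tailRows_apply, Finsupp.tsub_apply, Finsupp.add_apply, Finsupp.inf_apply,
        Finsupp.sup_apply] at h3 h4 h5 ⊢
      omega
  · rintro ⟨⟨u, j⟩, q⟩ h
    simp only [Finset.mem_sigma] at h ⊢
    obtain ⟨⟨hu, hj⟩, hq⟩ := h
    have h1 := hback u q j hu hq
    have h2 := hdb u q j hu hq
    have h3 := hdeg q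
    have h4 := degree_tailRows (q ⊔ p)
    have h5 := (mem_addStrip.1 hq).2.2
    have hj' := Finset.mem_range.1 hj
    refine ⟨mem_addStrip.2 ⟨fun i => ?_, fun i => ?_, ?_⟩, Finset.mem_Icc.2 ⟨fun i => ?_,
      fun i => ?_⟩⟩
    · rcases i with _ | i
      · simp only [consRow_zero, Finsupp.sup_apply]; omega
      · have h6 := h1.1 i
        simp only [consRow_succ, tailRows_apply, Finsupp.tsub_apply, Finsupp.add_apply,
          Finsupp.inf_apply, Finsupp.sup_apply] at h6 ⊢
        omega
    · have h6 := h1.1 i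
      have h7 := h1.2 i
      simp only [consRow_succ, tailRows_apply, Finsupp.tsub_apply, Finsupp.add_apply,
          Finsupp.inf_apply, Finsupp.sup_apply] at h6 h7 ⊢
      omega
    · rw [degree_consRow]
      omega
    · have h6 := h1.1 i
      have h7 := h1.2 i
      simp only [consRow_succ, tailRows_apply, Finsupp.tsub_apply, Finsupp.add_apply,
          Finsupp.inf_apply, Finsupp.sup_apply] at h6 h7 ⊢
      omega
    · rcases i with _ | i
      · simp only [consRow_zero, Finsupp.sup_apply]; omega
      · have h6 := h1.1 i
        simp only [consRow_succ, tailRows_apply, Finsupp.tsub_apply, Finsupp.add_apply,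
          Finsupp.inf_apply, Finsupp.sup_apply] at h6 ⊢
        omega
  · rintro ⟨s, q⟩ h
    simp only [Finset.mem_sigma] at h
    obtain ⟨hs, hq⟩ := h
    have h1 := hforth s q hs hq
    simp only [Sigma.mk.injEq, heq_eq_eq, and_true]
    ext i
    rcases i with _ | i
    · have h2 := h1.1 0
      rw [consRow_zero]
      omega
    · have h2 := h1.1 (i + 1)
      have h3 := h1.2 i
      simp only [consRow_succ, tailRows_apply, Finsupp.tsub_apply, Finsupp.add_apply,
          Finsupp.inf_apply, Finsupp.sup_apply] at h2 h3 ⊢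
      omega
  · rintro ⟨⟨u, j⟩, q⟩ h
    simp only [Finset.mem_sigma] at h
    obtain ⟨⟨hu, hj⟩, hq⟩ := h
    have h1 := hback u q j hu hq
    simp only [Sigma.mk.injEq, heq_eq_eq, and_true, tailRows_consRow, consRow_zero]
    refine ⟨?_, by omega⟩
    ext i
    have h6 := h1.1 i
    have h7 := h1.2 i
    simp only [tailRows_apply, Finsupp.tsub_apply, Finsupp.add_apply,
        Finsupp.inf_apply, Finsupp.sup_apply] at h6 h7 ⊢
    omega
  · rintro ⟨s, q⟩ h
    simp only [Finset.mem_sigma] at h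
    obtain ⟨hs, hq⟩ := h
    have h2 := hfacts s q hs hq
    simp only
    congr 1
    omega

/-- Induction on the number of variables: expanding both sides by the branching rule, the local rule
reduces the claim to the same statement for each u in N variables. -/
theorem tabSeries_mul (N r : ℕ) {p : ℕ →₀ ℕ} (hp : Antitone p) :
    tabSeries N p * tabSeries N (Finsupp.single 0 r) = ∑ q ∈ addStrip r p, tabSeries N q := by
  induction N generalizing p r with
  | zero =>
    simp only [tabSeries_zero, Finsupp.single_eq_zero]
    by_cases hr : r = 0
    · subst hr
      have : addStrip 0 p = {p} := by
        ext q
        rw [mem_addStrip, Finset.mem_singleton]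
        constructor
        · rintro ⟨h1, -, h2⟩
          have h3 := degree_sub h1
          have h4 : (q - p).degree = 0 := by omega
          rw [Finsupp.degree_eq_zero_iff, tsub_eq_zero_iff_le] at h4
          exact le_antisymm h4 h1
        · rintro rfl
          exact ⟨le_rfl, fun i => hp (Nat.le_succ i), rfl⟩
      simp [this, eq_comm]
    · rw [Finset.sum_eq_zero]
      · simp [hr]
      · intro q hq
        rw [if_neg]
        rintro rfl
        have := (mem_addStrip.1 hq).2.2
        simp at this
        omega
  | succ N ih =>
    rw [Finset.sum_congr rfl fun q hq => tabSeries_succ N (antitone_of_mem_addStrip hq),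
      sum_add_remove_strips r (fun d q => (MvPowerSeries.X N : Ser) ^ d * tabSeries N q),
      tabSeries_succ N hp, tabSeries_single_succ, Finset.sum_mul]
    refine Finset.sum_congr rfl fun u hu => ?_
    rw [Finset.mul_sum]
    refine Finset.sum_congr rfl fun j _ => ?_
    rw [← Finset.mul_sum, ← ih _ (antitone_of_mem_Icc hu), pow_add]
    ring

/-! ### The Pieri rule in infinitely many variables -/

/-- The Schur function with row lengths `p`. -/
def rowSchur (p : ℕ →₀ ℕ) : Ser := skewSchur (rowCells p)

/-- Fillings of content m use only letters from the support of m, so N variables suffice. -/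
theorem coeff_rowSchur {N : ℕ} {m : ℕ →₀ ℕ} (hm : ∀ a, m a ≠ 0 → a < N) (p : ℕ →₀ ℕ) :
    MvPowerSeries.coeff m (rowSchur p) = MvPowerSeries.coeff m (tabSeries N p) := by
  rw [rowSchur, skewSchur_eq_genSeries, tabSeries, coeff_genSeries, coeff_genSeries]
  congr 2
  ext T
  refine ⟨fun h => ⟨⟨h.1, fun c => hm _ ?_⟩, h.2⟩, fun h => ⟨h.1.1, h.2⟩⟩
  rw [← h.2, letterCount_apply]
  exact Finset.card_ne_zero_of_mem (Finset.mem_filter.2 ⟨Finset.mem_univ c, rfl⟩)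

theorem rowSchur_single (r : ℕ) : rowSchur (Finsupp.single 0 r) = hsym r := by
  rw [← ribbon_empty, ← skewSchur_ribbonDiagram, rowSchur]
  congr 1
  ext ⟨i, j⟩
  rw [mem_rowCells, mem_ribbonDiagram]
  simp only [ribbonCell, numBelow, Finset.filter_empty, Finset.card_empty, Nat.sub_zero,
    Prod.mk.injEq]
  rcases i with _ | i
  · simp
  · simp

theorem rowSchur_mul_hsym (r : ℕ) {p : ℕ →₀ ℕ} (hp : Antitone p) :
    rowSchur p * hsym r = ∑ q ∈ addStrip r p, rowSchur q := by
  classical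
  ext m
  obtain ⟨N, hN⟩ : ∃ N, ∀ a, m a ≠ 0 → a < N :=
    ⟨m.support.sup id + 1, fun a ha => Nat.lt_succ_of_le
      (Finset.le_sup (f := id) (Finsupp.mem_support_iff.2 ha))⟩
  rw [map_sum, Finset.sum_congr rfl fun q _ => coeff_rowSchur hN q, ← map_sum,
    ← tabSeries_mul N r hp, ← rowSchur_single, MvPowerSeries.coeff_mul, MvPowerSeries.coeff_mul]
  refine Finset.sum_congr rfl fun x hx => ?_
  have hx' := Finset.HasAntidiagonal.mem_antidiagonal.1 hx
  have h1 : ∀ a, x.1 a ≠ 0 → a < N := fun a ha => hN a (by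
    rw [← hx', Finsupp.add_apply]; omega)
  have h2 : ∀ a, x.2 a ≠ 0 → a < N := fun a ha => hN a (by
    rw [← hx', Finsupp.add_apply]; omega)
  rw [coeff_rowSchur h1, coeff_rowSchur h2]

/-! ### Lattice words -/

/-- The exponent vector of the first `k` letters of a word. -/
def prefixCount {n : ℕ} (y : Fin n → ℕ) (k : ℕ) : ℕ →₀ ℕ :=
  ∑ i, if i.1 < k then Finsupp.single (y i) 1 else 0

/-- Adding cells to the rows `y 0, y 1, …` of the empty diagram in turn gives Young diagrams. -/
def IsLatticeWord {n : ℕ} (y : Fin n → ℕ) : Prop := ∀ k, Antitone (prefixCount y k)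

theorem prefixCount_apply {n : ℕ} (y : Fin n → ℕ) (k a : ℕ) :
    prefixCount y k a = (Finset.univ.filter fun i : Fin n => i.1 < k ∧ y i = a).card := by
  classical
  rw [prefixCount, Finsupp.finsetSum_apply, Finset.card_filter]
  refine Finset.sum_congr rfl fun i _ => ?_
  by_cases h : i.1 < k <;> simp [h, Finsupp.single_apply]

theorem prefixCount_of_le {n : ℕ} (y : Fin n → ℕ) {k : ℕ} (h : n ≤ k) :
    prefixCount y k = letterCount y :=
  Finset.sum_congr rfl fun i _ => if_pos (i.2.trans_le h)

theorem prefixCount_zero {n : ℕ} (y : Fin n → ℕ) : prefixCount y 0 = 0 := by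
  simp [prefixCount]

theorem prefixCount_append {n r : ℕ} (u : Fin n → ℕ) (v : Fin r → ℕ) (k : ℕ) :
    prefixCount (Fin.append u v) k = prefixCount u k + prefixCount v (k - n) := by
  simp only [prefixCount, Fin.sum_univ_add, Fin.append_left, Fin.append_right, Fin.val_castAdd,
    Fin.val_natAdd, Nat.lt_sub_iff_add_lt']

theorem IsLatticeWord.antitone_letterCount {n : ℕ} {y : Fin n → ℕ} (h : IsLatticeWord y) :
    Antitone (letterCount y) := prefixCount_of_le y le_rfl ▸ h n

theorem prefixCount_le_letterCount {n : ℕ} (y : Fin n → ℕ) (k : ℕ) :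
    prefixCount y k ≤ letterCount y := by
  intro a
  rw [prefixCount_apply, letterCount_apply]
  exact Finset.card_le_card fun i hi => by simp at hi ⊢; exact hi.2

theorem isLatticeWord_append_iff {n r : ℕ} (u : Fin n → ℕ) (v : Fin r → ℕ) :
    IsLatticeWord (Fin.append u v) ↔
      IsLatticeWord u ∧ ∀ k, Antitone (letterCount u + prefixCount v k) := by
  constructor
  · intro h
    refine ⟨fun k => ?_, fun k => ?_⟩
    · rcases le_total k n with hk | hk
      · have := h k
        rwa [prefixCount_append, Nat.sub_eq_zero_of_le hk, prefixCount_zero, add_zero] at this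
      · have := h n
        rwa [prefixCount_append, Nat.sub_self, prefixCount_zero, add_zero,
          prefixCount_of_le u le_rfl, ← prefixCount_of_le u hk] at this
    · have := h (n + k)
      rwa [prefixCount_append, Nat.add_sub_cancel_left, prefixCount_of_le u (by omega)] at this
  · rintro ⟨h1, h2⟩ k
    rw [prefixCount_append]
    rcases le_total k n with hk | hk
    · rw [Nat.sub_eq_zero_of_le hk, prefixCount_zero, add_zero]
      exact h1 k
    · rw [prefixCount_of_le u hk]
      exact h2 _

/-- With lower rows filled first, row i+1 receives all its new cells before row i receives any. At
that moment the shape is a diagram exactly when the new row i+1 does not exceed the old row i. -/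
theorem antitone_add_prefixCount_iff {r : ℕ} {p : ℕ →₀ ℕ} {v : Fin r → ℕ}
    (hv : Antitone v) :
    (∀ k, Antitone (p + prefixCount v k)) ↔ p + letterCount v ∈ addStrip r p := by
  rw [mem_addStrip]
  have hdeg : (p + letterCount v).degree = p.degree + r := by
    rw [map_add, degree_letterCount, Fintype.card_fin]
  simp only [le_self_add, hdeg, and_true, true_and]
  constructor
  · intro h i
    -- k is the number of letters at least i+1; they form a prefix of v.
    obtain ⟨k, -, hk⟩ := exists_threshold r (fun j => ∃ hj : j < r, i + 1 ≤ v ⟨j, hj⟩)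
      fun a b hab hb ⟨_, h1⟩ => ⟨hab.trans_lt hb, h1.trans (hv hab)⟩
    have h1 : prefixCount v k (i + 1) = letterCount v (i + 1) := by
      rw [prefixCount_apply, letterCount_apply]
      congr 1
      refine Finset.filter_congr fun j _ => ⟨fun h => h.2, fun h => ⟨?_, h⟩⟩
      exact (hk j.1 j.2).1 ⟨j.2, h.ge⟩
    have h2 : prefixCount v k i = 0 := by
      rw [prefixCount_apply, Finset.card_eq_zero, Finset.filter_eq_empty_iff]
      rintro j - ⟨h3, h4⟩
      obtain ⟨_, h5⟩ := (hk j.1 j.2).2 h3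
      have h6 : i + 1 ≤ v j := h5
      omega
    have h3 := h k (Nat.le_succ i)
    rw [Nat.succ_eq_add_one, Finsupp.add_apply, Finsupp.add_apply, h1, h2, add_zero] at h3
    exact h3
  · intro h k
    refine antitone_nat_of_succ_le fun i => ?_
    have h1 := h i
    have h2 := prefixCount_le_letterCount v k (i + 1)
    rw [tailRows_apply] at h1
    rw [Finsupp.add_apply] at h1 ⊢
    rw [Finsupp.add_apply]
    omega

/-- If row `y i` is nonempty, so are all rows above it, which takes at least `y i + 1` cells. This
confines lattice words to a finite set. -/
theorem IsLatticeWord.lt {n : ℕ} {y : Fin n → ℕ} (h : IsLatticeWord y) (i : Fin n) : y i < n := by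
  have h1 : 1 ≤ letterCount y (y i) := by
    rw [letterCount_apply]
    exact Finset.card_pos.2 ⟨i, by simp⟩
  have h2 : ∑ b ∈ Finset.range (y i + 1), letterCount y b ≤ (letterCount y).degree := by
    rw [Finsupp.degree_apply]
    exact Finset.sum_le_sum_of_ne_zero fun b _ hb => Finsupp.mem_support_iff.2 hb
  have h3 : ∑ b ∈ Finset.range (y i + 1), 1 ≤ ∑ b ∈ Finset.range (y i + 1), letterCount y b :=
    Finset.sum_le_sum fun b hb => h1.trans (h.antitone_letterCount (by
      have := Finset.mem_range.1 hb; omega))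
  rw [degree_letterCount, Fintype.card_fin] at h2
  simp only [Finset.sum_const, Finset.card_range, smul_eq_mul, mul_one] at h3
  omega

open Classical in
/-- The lattice words of length `n` whose set of ascents is `S`. -/
def latticeWords (n : ℕ) (S : Finset ℕ) : Finset (Fin n → ℕ) :=
  {y ∈ Fintype.piFinset fun _ : Fin n => Finset.range n |
    IsLatticeWord y ∧ HasDescents S fun i => OrderDual.toDual (y i)}

theorem mem_latticeWords {n : ℕ} {S : Finset ℕ} {y : Fin n → ℕ} :
    y ∈ latticeWords n S ↔ IsLatticeWord y ∧ HasDescents S fun i => OrderDual.toDual (y i) := by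
  classical
  rw [latticeWords, Finset.mem_filter, and_iff_right_iff_imp, Fintype.mem_piFinset]
  exact fun h i => Finset.mem_range.2 (h.1.lt i)

/-- The sum of the Schur functions attached to the lattice words with ascent set `S`. -/
def latticeSum (n : ℕ) (S : Finset ℕ) : Ser := ∑ y ∈ latticeWords n S, rowSchur (letterCount y)

theorem antitone_iff_toDual {r : ℕ} (v : Fin r → ℕ) :
    Antitone v ↔ Monotone fun i => OrderDual.toDual (v i) := Iff.rfl

theorem latticeSum_empty (r : ℕ) : latticeSum r ∅ = hsym r := by
  have h0 : rowSchur 0 = 1 := by rw [← hsym_zero, ← rowSchur_single, Finsupp.single_zero]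
  have hz : Antitone (0 : ℕ →₀ ℕ) := fun _ _ _ => le_rfl
  rw [← one_mul (hsym r), ← h0, rowSchur_mul_hsym r hz, latticeSum]
  have hl : ∀ y : Fin r → ℕ, y ∈ latticeWords r ∅ ↔ Antitone y ∧ letterCount y ∈ addStrip r 0 := by
    intro y
    rw [mem_latticeWords, hasDescents_empty_iff, ← antitone_iff_toDual, and_comm]
    refine and_congr_right fun hy => ?_
    have := antitone_add_prefixCount_iff (p := 0) hy
    simp only [zero_add] at this
    exact this
  refine Finset.sum_bij (fun y _ => letterCount y) ?_ ?_ ?_ ?_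
  · exact fun y hy => ((hl y).1 hy).2
  · intro y hy y' hy' h
    exact (existsUnique_antitone_letterCount (r := r) (m := letterCount y)
      (by rw [degree_letterCount, Fintype.card_fin])).unique ⟨((hl y).1 hy).1, rfl⟩
        ⟨((hl y').1 hy').1, h.symm⟩
  · intro q hq
    have hdeg : q.degree = r := by simpa using (mem_addStrip.1 hq).2.2
    obtain ⟨y, hy, rfl⟩ := (existsUnique_antitone_letterCount hdeg).exists
    exact ⟨y, (hl y).2 ⟨hy, hq⟩, rfl⟩
  · exact fun _ _ => rfl

/-- By the Pieri rule each term of the product is a lattice word u with a horizontal strip added to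
its shape. The strip is recorded by a unique weakly decreasing v, and the ascents of the
concatenation are those of u, possibly with the junction. -/
theorem latticeSum_mul_hsym {n r : ℕ} (hn : 1 ≤ n) (hr : 1 ≤ r) {S : Finset ℕ}
    (hS : S ⊆ Finset.range (n - 1)) :
    latticeSum n S * hsym r = latticeSum (n + r) S + latticeSum (n + r) (insert (n - 1) S) := by
  classical
  have hnS : n - 1 ∉ S := fun h => by simpa using hS h
  have happ : ∀ (u : Fin n → ℕ) (v : Fin r → ℕ), (fun i => OrderDual.toDual (Fin.append u v i)) =
      Fin.append (fun i => OrderDual.toDual (u i)) (fun i => OrderDual.toDual (v i)) := by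
    intro u v
    funext i
    refine Fin.addCases (fun i => ?_) (fun i => ?_) i <;> simp
  have hmem : ∀ (u : Fin n → ℕ) (v : Fin r → ℕ), Fin.append u v ∈
      latticeWords (n + r) S ∪ latticeWords (n + r) (insert (n - 1) S) ↔
      u ∈ latticeWords n S ∧ Antitone v ∧ letterCount u + letterCount v ∈
        addStrip r (letterCount u) := by
    intro u v
    rw [Finset.mem_union, mem_latticeWords, mem_latticeWords, mem_latticeWords, ← and_or_left,
      happ, ← hasDescents_append hn hS, isLatticeWord_append_iff, ← antitone_iff_toDual]
    constructor
    · rintro ⟨⟨h1, h2⟩, h3, h4⟩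
      exact ⟨⟨h1, h3⟩, h4, (antitone_add_prefixCount_iff h4).1 h2⟩
    · rintro ⟨⟨h1, h3⟩, h4, h2⟩
      exact ⟨⟨h1, (antitone_add_prefixCount_iff h4).2 h2⟩, h3, h4⟩
  have hdisj : Disjoint (latticeWords (n + r) S) (latticeWords (n + r) (insert (n - 1) S)) := by
    rw [Finset.disjoint_left]
    intro w h1 h2
    exact hnS (((mem_latticeWords.1 h1).2.mem_iff (mem_latticeWords.1 h2).2
      (i := n - 1) (by omega)).2 (by simp))
  rw [latticeSum, latticeSum, latticeSum, ← Finset.sum_union hdisj, Finset.sum_mul]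
  have h1 : ∀ u ∈ latticeWords n S, rowSchur (letterCount u) * hsym r =
      ∑ q ∈ addStrip r (letterCount u), rowSchur q := fun u hu =>
    rowSchur_mul_hsym r (mem_latticeWords.1 hu).1.antitone_letterCount
  rw [Finset.sum_congr rfl h1, Finset.sum_sigma']
  symm
  have hsplit : ∀ w : Fin (n + r) → ℕ, ∃ u v, w = Fin.append u v := fun w => by
    obtain ⟨⟨u, v⟩, h⟩ := (Fin.appendEquiv n r).surjective w
    exact ⟨u, v, h.symm⟩
  choose fst snd hsplit using hsplit
  have hfst : ∀ u v, fst (Fin.append u v) = u ∧ snd (Fin.append u v) = v := by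
    intro u v
    have := (Fin.appendEquiv n r).injective (a₁ := (u, v))
      (a₂ := (fst (Fin.append u v), snd (Fin.append u v))) (hsplit (Fin.append u v))
    rw [Prod.mk.injEq] at this
    exact ⟨this.1.symm, this.2.symm⟩
  refine Finset.sum_bij (fun w _ => ⟨fst w, letterCount w⟩) ?_ ?_ ?_ ?_
  · intro w hw
    obtain ⟨u, v, rfl⟩ : ∃ u v, w = Fin.append u v := ⟨_, _, hsplit w⟩
    rw [hmem] at hw
    rw [Finset.mem_sigma, (hfst u v).1, letterCount_append]
    exact ⟨hw.1, hw.2.2⟩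
  · intro w hw w' hw' h
    obtain ⟨u, v, rfl⟩ : ∃ u v, w = Fin.append u v := ⟨_, _, hsplit w⟩
    obtain ⟨u', v', rfl⟩ : ∃ u v, w' = Fin.append u v := ⟨_, _, hsplit w'⟩
    rw [hmem] at hw hw'
    simp only [(hfst _ _).1, letterCount_append, Sigma.mk.injEq, heq_eq_eq] at h
    obtain ⟨rfl, h⟩ := h
    rw [(existsUnique_antitone_letterCount (r := r) (m := letterCount v)
      (by rw [degree_letterCount, Fintype.card_fin])).unique ⟨hw.2.1, rfl⟩
        ⟨hw'.2.1, (add_left_cancel h).symm⟩]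
  · rintro ⟨u, q⟩ huq
    rw [Finset.mem_sigma] at huq
    obtain ⟨hu, hq⟩ := huq
    simp only at hu hq
    have h2 := mem_addStrip.1 hq
    have h3 := degree_sub h2.1
    obtain ⟨v, hv, hvc⟩ := (existsUnique_antitone_letterCount (r := r)
      (m := q - letterCount u) (by omega)).exists
    have hq' : letterCount u + letterCount v = q := by
      rw [hvc, add_tsub_cancel_of_le h2.1]
    refine ⟨Fin.append u v, (hmem u v).2 ⟨hu, hv, by rwa [hq']⟩, ?_⟩
    rw [(hfst u v).1, letterCount_append, hq']
  · exact fun _ _ => rfl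

/-- A ribbon Schur function is the sum of the Schur functions attached to the lattice words
with the corresponding ascent set. -/
theorem ribbon_eq_latticeSum {S : Finset ℕ} {n : ℕ} (hS : S ⊆ Finset.range (n - 1)) :
    ribbon n S = latticeSum n S := by
  -- The product rule at length s+1 expresses the term with largest element s through sets without
  -- s, in lengths s+1 and n; hence the length must vary in the induction.
  induction S using Finset.induction_on_max generalizing n with
  | empty => rw [ribbon_empty, latticeSum_empty]
  | insert s S hmax ih =>
    have hs : s < n - 1 := Finset.mem_range.1 (hS (Finset.mem_insert_self s S))
    obtain ⟨r, rfl⟩ := Nat.exists_eq_add_of_le (show s + 1 ≤ n by omega)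
    have hS' : S ⊆ Finset.range (s + 1 - 1) := fun i hi => Finset.mem_range.2 (hmax i hi)
    have h1 := ribbon_mul_hsym (n := s + 1) (r := r) (by omega) (by omega) hS'
    have h2 := latticeSum_mul_hsym (n := s + 1) (r := r) (by omega) (by omega) hS'
    rw [ih hS', h2, ih ((Finset.subset_insert s S).trans hS)] at h1
    exact (add_left_cancel h1).symm

/-! ### Schur positivity -/

theorem isPositive_sum {R ι κ : Type*} [CommRing R] [Algebra ℝ R] {b : ι → R} (A : Finset κ)
    {f : κ → R} (h : ∀ a ∈ A, IsPositive b (f a)) : IsPositive b (∑ a ∈ A, f a) := by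
  classical
  induction A using Finset.induction_on with
  | empty => exact ⟨0, fun _ => le_rfl, by simp⟩
  | insert a A ha ih =>
    obtain ⟨c, hc, hfc⟩ := h a (Finset.mem_insert_self a A)
    obtain ⟨d, hd, hfd⟩ := ih fun x hx => h x (Finset.mem_insert_of_mem hx)
    refine ⟨c + d, fun i => add_nonneg (hc i) (hd i), ?_⟩
    rw [Finset.sum_insert ha, hfc, hfd, Finsupp.sum_add_index'
      (h := fun i a => a • b i) (fun _ => zero_smul ℝ _) (fun _ _ _ => add_smul _ _ _)]

theorem isPositive_rowSchur {p : ℕ →₀ ℕ} (hp : Antitone p) : IsPositive schur (rowSchur p) := by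
  let lam : YoungDiagram := ⟨rowCells p, by
    intro a b hab ha
    rw [Finset.mem_coe, mem_rowCells] at ha ⊢
    exact (hab.2.trans_lt ha).trans_le (hp hab.1)⟩
  classical
  refine ⟨Finsupp.single lam 1, fun i => ?_, ?_⟩
  · rw [Finsupp.single_apply]
    split_ifs <;> norm_num
  · rw [Finsupp.sum_single_index (h := fun i a => a • schur i) (zero_smul ℝ _), one_smul]
    rfl

theorem isPositive_ribbon {n : ℕ} {S : Finset ℕ} (hS : S ⊆ Finset.range (n - 1)) :
    IsPositive schur (ribbon n S) := by
  rw [ribbon_eq_latticeSum hS]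
  exact isPositive_sum _ fun y hy =>
    isPositive_rowSchur (mem_latticeWords.1 hy).1.antitone_letterCount

theorem isPositive_gammaCoeff {n : ℕ} (hn : 1 ≤ n) (k : ℕ) :
    IsPositive schur (gammaCoeff n k) := by
  classical
  rw [gammaCoeff_eq hn]
  exact isPositive_sum _ fun S hS =>
    isPositive_ribbon (Finset.mem_powerset.1 (Finset.mem_filter.1 hS).1)

end SchurGamma

end

theorem corollary3p2 (n : ℕ) (hn : 1 ≤ n) :
    SchurGamma.polyQ n =
        ∑ k ∈ Finset.range ((n - 1) / 2 + 1),
          Polynomial.C (SchurGamma.gammaCoeff n k) * Polynomial.X ^ k *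
            (1 + Polynomial.X) ^ (n - 1 - 2 * k) ∧
      SchurGamma.IsGammaPositive SchurGamma.schur (n - 1) (SchurGamma.polyQ n) := by
  have h : SchurGamma.polyQ n = _ :=
    (SchurGamma.polyQ_eq_sparseSum hn).trans (SchurGamma.sparseSum_eq_sum_gammaCoeff hn)
  exact ⟨h, SchurGamma.gammaCoeff n, fun k _ => SchurGamma.isPositive_gammaCoeff hn k, h⟩
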